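/- Let $M$ be a complete smooth Riemannian surface (without boundary; no assumption on its curvature), let $T^1M$ be its unit tangent bundle and $(g_t)_{t\in\mathbb R}$ its geodesic flow, and let $d$ be any distance on $T^1M$ that induces its topology. Suppose that $M$ contains an embedded flat cylinder, that is, a compact subset $C$ that is isometric, as a Riemannian surface with boundary, to the Euclidean cylinder $[0,l]\times\mathbb R/2\pi h\mathbb Z$ for some $l,h>0$; its interior is the part of $C$ that corresponds to $(0,l)\times\mathbb R/2\pi h\mathbb Z$. Suppose also that the geodesic flow is transitive on $T^1M$: some $w\in T^1M$ has a dense orbit $\{g_tw : t\in\mathbb R\}$. Let $v\in T^1M$ be a periodic vector ($g_{l_0}v=v$ for some $l_0>0$) whose geodesic is contained in the interior of the cylinder. Then the closing lemma is not satisfied around $v$, that is, there is no neighborhood $V$ of $v$ in $T^1M$ with the following property: for every $\varepsilon>0$ there are $\delta>0$ and $T_0>0$ such that, for all $w\in V$ and all $T\ge T_0$ with $g_T(w)\in V$ and $d(g_T(w),w)<\delta$, there are $w_0\in T^1M$ and $l'>0$ with $g_{l'}w_0=w_0$, $|T-l'|<\varepsilon$, and $d(g_t(w),g_t(w_0))<\varepsilon$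 for all $t\in[0,T]$. -/

import Mathlib

open Set Filter Topology Bundle
open scoped Manifold ContDiff Bundle

noncomputable section

/-- The Euclidean plane, on which surfaces are modelled. -/
abbrev Plane : Type := EuclideanSpace ℝ (Fin 2)

section Surface

variable (M : Type*) [TopologicalSpace M] [ChartedSpace Plane M]
  [RiemannianBundle (fun x : M ↦ TangentSpace (𝓡 2) x)]

/-- The unit tangent bundle `T¹M` of a surface, with the topology induced by that of `TM`. -/
abbrev UnitTangentBundle [IsManifold (𝓡 2) ∞ M] : Type _ :=
  {p : TangentBundle (𝓡 2) M // ‖p.2‖ = 1}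

variable {M}

/-- The coefficients of the Riemannian metric in the chart `e`: the inner product, at the point of
`M` with coordinates `x`, of the tangent vectors with coordinates `a` and `b`. -/
def chartMetric (e : OpenPartialHomeomorph M Plane) (x a b : Plane) : ℝ :=
  inner ℝ (mfderiv (𝓡 2) (𝓡 2) e.symm x a) (mfderiv (𝓡 2) (𝓡 2) e.symm x b)

/-- The velocity `γ'(t)` of a curve in `M`, as a point of the tangent bundle. -/
def velocity (γ : ℝ → M) (t : ℝ) : TangentBundle (𝓡 2) M :=
  ⟨γ t, mfderiv 𝓘(ℝ, ℝ) (𝓡 2) γ t (1 : ℝ)⟩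

/-- A complete unit speed geodesic `γ : ℝ → M`: a smooth curve of unit speed which satisfies, in
every smooth chart, the geodesic equation
`d/dt (∑ⱼ gₖⱼ(x) xⱼ') = (1/2) ∑ᵢⱼ (∂ₖ gᵢⱼ)(x) xᵢ' xⱼ'`, that is, the Euler-Lagrange
equation of the energy, which is equivalent to
`xₖ'' + ∑ᵢⱼ Γᵏᵢⱼ(x) xᵢ' xⱼ' = 0`. It is written here against an arbitrary constant vector `ξ` in
place of the `k`-th basis vector. -/
structure IsUnitSpeedGeodesic [IsManifold (𝓡 2) ∞ M] (γ : ℝ → M) : Prop where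
  smooth : ContMDiff 𝓘(ℝ, ℝ) (𝓡 2) ∞ γ
  unit_speed : ∀ t, ‖(velocity γ t).2‖ = 1
  geodesic_eq : ∀ e ∈ IsManifold.maximalAtlas (𝓡 2) ∞ M, ∀ t, γ t ∈ e.source → ∀ ξ : Plane,
    HasDerivAt
      (fun s ↦ chartMetric e (e (γ s)) (deriv (fun r ↦ e (γ r)) s) ξ)
      (1 / 2 * fderiv ℝ
        (fun x ↦ chartMetric e x (deriv (fun r ↦ e (γ r)) t) (deriv (fun r ↦ e (γ r)) t))
        (e (γ t)) ξ) t

open Classical in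
/-- The geodesic flow `g_t` on `T¹M`: `g_t v = γ'(t)`, where `γ` is the geodesic with
`γ'(0) = v`. On a complete surface this geodesic exists for all times, for every `v` (and it is
always unique); the value `v` in the other case is a convention. -/
def geodesicFlow [IsManifold (𝓡 2) ∞ M] (t : ℝ) (v : UnitTangentBundle M) :
    UnitTangentBundle M :=
  if h : ∃ γ : ℝ → M, IsUnitSpeedGeodesic γ ∧ velocity γ 0 = v.1 then
    ⟨velocity h.choose t, h.choose_spec.1.unit_speed t⟩
  else v

variable (M) in
/-- The geodesic flow is transitive: some vector of `T¹M` has a dense orbit. -/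
def GeodesicFlowTransitive [IsManifold (𝓡 2) ∞ M] : Prop :=
  ∃ w : UnitTangentBundle M, Dense (range fun t : ℝ ↦ geodesicFlow t w)

/-- `w` is a periodic vector and `l > 0` is a period of it (not necessarily the least one). -/
def IsPeriodicVector [IsManifold (𝓡 2) ∞ M] (w : UnitTangentBundle M) (l : ℝ) : Prop :=
  0 < l ∧ geodesicFlow l w = w

/-- The closing lemma is satisfied around `v`, where `T¹M` carries the distance `d`. -/
def ClosingLemmaAround [IsManifold (𝓡 2) ∞ M]
    (d : UnitTangentBundle M → UnitTangentBundle M → ℝ) (v : UnitTangentBundle M) : Prop :=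
  ∃ V ∈ 𝓝 v, ∀ ε > 0, ∃ δ > 0, ∃ T₀ > 0, ∀ w ∈ V, ∀ T ≥ T₀,
    geodesicFlow T w ∈ V → d (geodesicFlow T w) w < δ →
      ∃ (w₀ : UnitTangentBundle M) (l : ℝ), IsPeriodicVector w₀ l ∧ |T - l| < ε ∧
        ∀ t ∈ Icc 0 T, d (geodesicFlow t w) (geodesicFlow t w₀) < ε

/-- The closed strip `[0, l] × ℝ` in the Euclidean plane. -/
def closedStrip (l : ℝ) : Set Plane := {p | p 0 ∈ Icc 0 l}

/-- The open strip `(0, l) × ℝ` in the Euclidean plane. -/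
def openStrip (l : ℝ) : Set Plane := {p | p 0 ∈ Ioo 0 l}

variable (M) in
/-- An embedded flat cylinder in `M`: an isometric embedding into `M` of the Euclidean cylinder
`[0, l] × ℝ / 2πhℤ`, where `l, h > 0`. It is given by its lift to the strip `[0, l] × ℝ`: a smooth
map whose differential preserves the norms of all vectors, and for which two points have the same
image exactly when they represent the same point of the cylinder. -/
structure EmbeddedFlatCylinder where
  /-- The width of the cylinder. -/
  l : ℝ
  /-- The radius of the cylinder: its vertical closed geodesics have length `2πh`. -/
  h : ℝ
  l_pos : 0 < l
  h_pos : 0 < h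
  /-- The parametrization of the cylinder by the strip. -/
  toFun : Plane → M
  smooth : ContMDiffOn (𝓡 2) (𝓡 2) ∞ toFun (closedStrip l)
  isometric : ∀ p ∈ closedStrip l, ∀ ξ : Plane,
    ‖mfderivWithin (𝓡 2) (𝓡 2) toFun (closedStrip l) p ξ‖ = ‖ξ‖
  eq_iff : ∀ p ∈ closedStrip l, ∀ q ∈ closedStrip l,
    toFun p = toFun q ↔ p 0 = q 0 ∧ ∃ n : ℤ, q 1 - p 1 = n * (2 * Real.pi * h)

/-- The interior of an embedded flat cylinder: the image of `(0, l) × ℝ / 2πhℤ`. -/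
def EmbeddedFlatCylinder.interior (C : EmbeddedFlatCylinder M) : Set M :=
  C.toFun '' openStrip C.l

/-- `v` generates a closed geodesic contained in `S`. -/
def GeneratesClosedGeodesicIn [IsManifold (𝓡 2) ∞ M] (v : UnitTangentBundle M) (S : Set M) :
    Prop :=
  (∃ l, IsPeriodicVector v l) ∧ ∀ t : ℝ, (geodesicFlow t v).1.proj ∈ S

end Surface

end

/-! Inside the flat cylinder a geodesic is a straight line: its height, the coordinate across the
cylinder, is affine in time, and the derivative of the height, its slope, is constant. A geodesic
that never leaves the cylinder therefore has slope zero, so `v` is vertical. A dense orbit passes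
arbitrarily close to `v` with positive slope and also with negative slope. Cutting it between two
such passages gives `w` and `T ≥ 0` such that `w` and `g_T w` are both close to `v` but have slopes
of opposite signs. The turn can only take place outside the cylinder.

A closed geodesic of period `l'` close to `T` cannot shadow this. Say that `w` starts upwards from
height about `x`. It climbs to a level `b` well above `x`, so its shadow `w₀` must climb as well and
has positive slope at time `0`. Reversing time, `w₀` has negative slope at time `T`. At that moment
`w₀` is well inside the cylinder, and with speed at most `1` it stays inside between the times `T`
and `l'`. Its slope at time `l'` is then still negative, whereas periodicity makes it equal to the
slope at time `0`.

The bound `T ≥ T₀` holds as soon as the slope of `w` is small, since the climb to `b` takes long. As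
`d` is arbitrary, closeness for `d` is turned into closeness of heights by compactness of the unit
vectors over a closed band of heights, and heights are compared only while `w` is over that band.

The contradiction is `IsStraightIn.not_shadow`, a statement about two real functions.
`isStraightIn_height` shows that heights along geodesics are such functions, and
`exists_geodesicFlow_slope_mul_neg` extracts `w` and `T` from transitivity. Since `geodesicFlow` is
meaningful only where complete geodesics exist, existence, uniqueness and completeness of geodesics
are proved too (`exists_isUnitSpeedGeodesic`, `eqOn_of_velocity_eq`). This is done with the momentum
`G(c) c'`, which gives a first-order equation on the cotangent bundle and needs no Christoffel
symbols. -/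

noncomputable section

set_option maxSynthPendingDepth 3

/-! ### The geodesic equation of a metric on a vector space -/

section CoordinateGeodesics

variable {E : Type*} [NormedAddCommGroup E] [NormedSpace ℝ E]

theorem hasDerivAt_fst_comp {F : Type*} [NormedAddCommGroup F] [NormedSpace ℝ F] {z : ℝ → E × F}
    {z' : E × F} {t : ℝ} (h : HasDerivAt z z' t) : HasDerivAt (fun s ↦ (z s).1) z'.1 t :=
  (ContinuousLinearMap.fst ℝ E F).hasFDerivAt.comp_hasDerivAt t h

theorem hasDerivAt_snd_comp {F : Type*} [NormedAddCommGroup F] [NormedSpace ℝ F] {z : ℝ → E × F}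
    {z' : E × F} {t : ℝ} (h : HasDerivAt z z' t) : HasDerivAt (fun s ↦ (z s).2) z'.2 t :=
  (ContinuousLinearMap.snd ℝ E F).hasFDerivAt.comp_hasDerivAt t h

/-- The covector `ξ ↦ (1/2) (∂_ξ G)(x)(a, a)`, the right-hand side of the geodesic equation of the
metric `G`. -/
def lagrangeForce (G : E → E →L[ℝ] E →L[ℝ] ℝ) (x a : E) : E →L[ℝ] ℝ :=
  (1 / 2 : ℝ) • ((fderiv ℝ G x).flip a).flip a

theorem lagrangeForce_apply (G : E → E →L[ℝ] E →L[ℝ] ℝ) (x a ξ : E) :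
    lagrangeForce G x a ξ = 1 / 2 * fderiv ℝ G x ξ a a := by
  simp [lagrangeForce]

/-- The curve `c` satisfies at time `t` the geodesic equation of the metric `G`. -/
def IsCoordGeodesicAt (G : E → E →L[ℝ] E →L[ℝ] ℝ) (c : ℝ → E) (t : ℝ) : Prop :=
  HasDerivAt (fun s ↦ G (c s) (deriv c s)) (lagrangeForce G (c t) (deriv c t)) t

/-- The vector field on the cotangent bundle that generates the geodesic flow of `G`. -/
def hamiltonField (G : E → E →L[ℝ] E →L[ℝ] ℝ) (z : E × (E →L[ℝ] ℝ)) : E × (E →L[ℝ] ℝ) :=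
  ((G z.1).inverse z.2, lagrangeForce G z.1 ((G z.1).inverse z.2))

theorem contDiffAt_hamiltonField [CompleteSpace E] {G : E → E →L[ℝ] E →L[ℝ] ℝ} {x : E}
    (hG : ContDiffAt ℝ ∞ G x) (hi : (G x).IsInvertible) (p : E →L[ℝ] ℝ) :
    ContDiffAt ℝ ∞ (hamiltonField G) (x, p) := by
  have h1 : ContDiffAt ℝ ∞ (fun z : E × (E →L[ℝ] ℝ) ↦ G z.1) (x, p) :=
    ContDiffAt.comp (x, p) hG contDiffAt_fst
  have hinv : ContDiffAt ℝ ∞ (fun z : E × (E →L[ℝ] ℝ) ↦ (G z.1).inverse) (x, p) := by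
    have h2 : ContDiffAt ℝ ∞ (ContinuousLinearMap.inverse :
        (E →L[ℝ] E →L[ℝ] ℝ) → ((E →L[ℝ] ℝ) →L[ℝ] E)) (G x) := hi.contDiffAt_map_inverse
    exact ContDiffAt.comp (x, p) h2 h1
  have ha : ContDiffAt ℝ ∞ (fun z : E × (E →L[ℝ] ℝ) ↦ (G z.1).inverse z.2) (x, p) :=
    hinv.clm_apply contDiffAt_snd
  have hd : ContDiffAt ℝ ∞ (fun z : E × (E →L[ℝ] ℝ) ↦ fderiv ℝ G z.1) (x, p) := by
    have h3 : ContDiffAt ℝ ∞ (fderiv ℝ G) x := hG.fderiv_right (by simp)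
    exact ContDiffAt.comp (x, p) h3 contDiffAt_fst
  have hf1 : ContDiffAt ℝ ∞ (fun z : E × (E →L[ℝ] ℝ) ↦ (fderiv ℝ G z.1).flip) (x, p) :=
    ContDiffAt.comp (x, p)
      (ContinuousLinearMap.flipₗᵢ ℝ E E (E →L[ℝ] ℝ)).toContinuousLinearEquiv.contDiff.contDiffAt hd
  have hf2 := hf1.clm_apply ha
  have hf3 := ContDiffAt.comp (x, p)
    (ContinuousLinearMap.flipₗᵢ ℝ E E ℝ).toContinuousLinearEquiv.contDiff.contDiffAt hf2
  have h4 : ContDiffAt ℝ ∞ (fun z : E × (E →L[ℝ] ℝ) ↦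
      lagrangeForce G z.1 ((G z.1).inverse z.2)) (x, p) := hf3.clm_apply ha |>.const_smul (1 / 2 : ℝ)
  exact ha.prodMk h4

/-- Legendre transform: passing to the momentum turns the second-order equation into an integral
curve of `hamiltonField`, to which the theory of first-order equations applies. -/
theorem hasDerivAt_hamiltonField {G : E → E →L[ℝ] E →L[ℝ] ℝ} {c : ℝ → E} {t : ℝ}
    (hi : (G (c t)).IsInvertible) (hc : DifferentiableAt ℝ c t) (h : IsCoordGeodesicAt G c t) :
    HasDerivAt (fun s ↦ (c s, G (c s) (deriv c s)))
      (hamiltonField G (c t, G (c t) (deriv c t))) t := by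
  have : (G (c t)).inverse (G (c t) (deriv c t)) = deriv c t := hi.inverse_apply_self _
  simp only [hamiltonField, this]
  exact hc.hasDerivAt.prodMk h

/-- The first component of the equation identifies the second one as the momentum of the base curve.
This identification is differentiated, so it is needed on a neighbourhood of `t`. -/
theorem isCoordGeodesicAt_of_hamiltonField {G : E → E →L[ℝ] E →L[ℝ] ℝ}
    {z : ℝ → E × (E →L[ℝ] ℝ)} {t : ℝ}
    (h : ∀ᶠ s in 𝓝 t, (G (z s).1).IsInvertible ∧ HasDerivAt z (hamiltonField G (z s)) s) :
    IsCoordGeodesicAt G (fun s ↦ (z s).1) t := by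
  have h1 : ∀ᶠ s in 𝓝 t, deriv (fun s ↦ (z s).1) s = (G (z s).1).inverse (z s).2 := by
    filter_upwards [h] with s hs
    exact (hasDerivAt_fst_comp hs.2).deriv
  have h2 : (fun s ↦ G (z s).1 (deriv (fun s ↦ (z s).1) s)) =ᶠ[𝓝 t] fun s ↦ (z s).2 := by
    filter_upwards [h, h1] with s hs h1s
    rw [h1s, hs.1.self_apply_inverse]
  unfold IsCoordGeodesicAt
  rw [h1.self_of_nhds]
  exact HasDerivAt.congr_of_eventuallyEq (hasDerivAt_snd_comp h.self_of_nhds.2) h2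

/-- A geodesic is determined by its position and velocity at one time. -/
theorem eventuallyEq_of_isCoordGeodesicAt [CompleteSpace E] {G : E → E →L[ℝ] E →L[ℝ] ℝ}
    {U : Set E} (hU : IsOpen U) (hG : ContDiffOn ℝ ∞ G U) (hi : ∀ x ∈ U, (G x).IsInvertible)
    {c₁ c₂ : ℝ → E} {t : ℝ} (h0 : c₁ t = c₂ t) (h0' : deriv c₁ t = deriv c₂ t) (hU₁ : c₁ t ∈ U)
    (h₁ : ∀ᶠ s in 𝓝 t, DifferentiableAt ℝ c₁ s ∧ IsCoordGeodesicAt G c₁ s)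
    (h₂ : ∀ᶠ s in 𝓝 t, DifferentiableAt ℝ c₂ s ∧ IsCoordGeodesicAt G c₂ s) :
    c₁ =ᶠ[𝓝 t] c₂ := by
  have key : ∀ c : ℝ → E, c t ∈ U →
      (∀ᶠ s in 𝓝 t, DifferentiableAt ℝ c s ∧ IsCoordGeodesicAt G c s) →
      ∀ S ∈ 𝓝 (c t, G (c t) (deriv c t)), ∀ᶠ s in 𝓝 t,
        HasDerivAt (fun s ↦ (c s, G (c s) (deriv c s)))
          (hamiltonField G (c s, G (c s) (deriv c s))) s ∧ (c s, G (c s) (deriv c s)) ∈ S := by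
    intro c hcU hc S hS
    have hcU' := hc.self_of_nhds.1.continuousAt.eventually_mem (hU.mem_nhds hcU)
    have hS' := (hasDerivAt_hamiltonField (hi _ hcU) hc.self_of_nhds.1
      hc.self_of_nhds.2).continuousAt.eventually_mem hS
    filter_upwards [hc, hcU', hS'] with s hs hsU hsS
    exact ⟨hasDerivAt_hamiltonField (hi _ hsU) hs.1 hs.2, hsS⟩
  have hs := contDiffAt_hamiltonField (hG.contDiffAt (hU.mem_nhds hU₁)) (hi _ hU₁)
    (G (c₁ t) (deriv c₁ t))
  obtain ⟨K, S, hS, hL⟩ := (hs.of_le (by simp : (1 : ℕ∞ω) ≤ ∞)).exists_lipschitzOnWith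
  have heq : (c₁ t, G (c₁ t) (deriv c₁ t)) = (c₂ t, G (c₂ t) (deriv c₂ t)) := by rw [h0, h0']
  have := ODE_solution_unique_of_eventually (v := fun _ ↦ hamiltonField G) (s := fun _ ↦ S)
    (K := K) (t₀ := t) (Eventually.of_forall fun _ ↦ hL) (key c₁ hU₁ h₁ S hS)
    (key c₂ (h0 ▸ hU₁) h₂ S (heq ▸ hS)) heq
  filter_upwards [this] with s hs
  exact congrArg Prod.fst hs

/-- Picard–Lindelöf for `hamiltonField`. The same `ε` serves all nearby initial data, which is what
the extension of geodesics requires. -/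
theorem exists_isCoordGeodesicAt [CompleteSpace E] {G : E → E →L[ℝ] E →L[ℝ] ℝ}
    {U : Set E} (hU : IsOpen U) (hG : ContDiffOn ℝ ∞ G U) (hi : ∀ x ∈ U, (G x).IsInvertible)
    {x₀ : E} (hx₀ : x₀ ∈ U) (a₀ : E) :
    ∃ ε > 0, ∀ᶠ q : E × E in 𝓝 (x₀, a₀), ∃ c : ℝ → E, c 0 = q.1 ∧ deriv c 0 = q.2 ∧
      ∀ t ∈ Ioo (-ε) ε, c t ∈ U ∧ ContDiffAt ℝ ∞ c t ∧ IsCoordGeodesicAt G c t := by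
  have hs := contDiffAt_hamiltonField (hG.contDiffAt (hU.mem_nhds hx₀)) (hi _ hx₀) (G x₀ a₀)
  obtain ⟨ε, hε, a, r, L, K, hr, hpl⟩ :=
    IsPicardLindelof.of_contDiffAt_one (hs.of_le (by simp : (1 : ℕ∞ω) ≤ ∞))
  obtain ⟨α, hα, hαc⟩ := (hpl 0).exists_forall_mem_closedBall_eq_hasDerivWithinAt_continuousOn
  have hb : Metric.closedBall (x₀, G x₀ a₀) (r : ℝ) ∈ 𝓝 (x₀, G x₀ a₀) :=
    Metric.closedBall_mem_nhds _ hr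
  have hI : Icc (0 - ε) (0 + ε) ∈ 𝓝 (0 : ℝ) := Icc_mem_nhds (by linarith) (by linarith)
  have hcont : ContinuousAt α ((x₀, G x₀ a₀), 0) := by
    refine hαc.continuousAt ?_
    exact prod_mem_nhds hb hI
  have h0 : α ((x₀, G x₀ a₀), 0) = (x₀, G x₀ a₀) := (hα _ (mem_of_mem_nhds hb)).1
  -- Joint continuity of the local flow keeps the position in `U` for a short time, uniformly in the
  -- initial data.
  have hev : ∀ᶠ q in 𝓝 (((x₀, G x₀ a₀), 0) : (E × (E →L[ℝ] ℝ)) × ℝ), (α q).1 ∈ U := by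
    refine (continuousAt_fst.comp hcont).eventually_mem ?_
    simp only [Function.comp, h0]
    exact hU.mem_nhds hx₀
  rw [nhds_prod_eq, eventually_prod_iff] at hev
  obtain ⟨p₁, hp₁, p₂, hp₂, hp⟩ := hev
  obtain ⟨ε', hε', hεp⟩ := Metric.eventually_nhds_iff.1 hp₂
  have hGa : ContinuousAt (fun q : E × E ↦ (q.1, G q.1 q.2)) (x₀, a₀) := by
    have hGc : ContinuousAt (fun q : E × E ↦ G q.1) (x₀, a₀) :=
      ContinuousAt.comp (f := fun q : E × E ↦ q.1) (x := (x₀, a₀))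
        (hG.contDiffAt (hU.mem_nhds hx₀)).continuousAt continuousAt_fst
    exact continuousAt_fst.prodMk (hGc.clm_apply continuousAt_snd)
  have hq := hGa.eventually (p := fun z ↦ z ∈ Metric.closedBall (x₀, G x₀ a₀) (r : ℝ) ∧ p₁ z)
    ((eventually_mem_set.2 hb).and hp₁)
  have hqU : ∀ᶠ q : E × E in 𝓝 (x₀, a₀), q.1 ∈ U :=
    continuousAt_fst.eventually_mem (hU.mem_nhds hx₀)
  refine ⟨min ε ε', lt_min hε hε', ?_⟩
  filter_upwards [hq, hqU] with q ⟨hqb, hqp⟩ hqU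
  obtain ⟨hα0, hαd⟩ := hα _ hqb
  set z : ℝ → E × (E →L[ℝ] ℝ) := fun t ↦ α ((q.1, G q.1 q.2), t) with hz
  have hd : ∀ t ∈ Ioo (-min ε ε') (min ε ε'), (z t).1 ∈ U ∧
      HasDerivAt z (hamiltonField G (z t)) t := by
    intro t ht
    have h1 : |t| < min ε ε' := abs_lt.2 ht
    have h1' := abs_lt.1 (h1.trans_le (min_le_left _ _))
    refine ⟨hp hqp (hεp (by simpa using h1.trans_le (min_le_right _ _))), ?_⟩
    exact (hαd t ⟨by linarith [h1'.1], by linarith [h1'.2]⟩).hasDerivAt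
      (Icc_mem_nhds (by linarith [h1'.1]) (by linarith [h1'.2]))
  have h0mem : (0 : ℝ) ∈ Ioo (-min ε ε') (min ε ε') := by
    have := lt_min hε hε'
    exact ⟨by linarith, this⟩
  have hsmooth : ∀ t ∈ Ioo (-min ε ε') (min ε ε'), ContDiffAt ℝ ∞ z t := by
    intro t ht
    obtain ⟨t₁, h1, h1'⟩ := exists_between ht.1
    obtain ⟨t₂, h2, h2'⟩ := exists_between ht.2
    have hsub : Icc t₁ t₂ ⊆ Ioo (-min ε ε') (min ε ε') := fun s hs ↦
      ⟨h1.trans_le hs.1, hs.2.trans_lt h2'⟩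
    have hf : ContDiffOn ℝ ∞ (Function.uncurry fun _ : ℝ ↦ hamiltonField G)
        (Icc t₁ t₂ ×ˢ (U ×ˢ (univ : Set (E →L[ℝ] ℝ)))) := by
      rintro ⟨s, x, p⟩ ⟨-, hx, -⟩
      have := contDiffAt_hamiltonField (hG.contDiffAt (hU.mem_nhds hx)) (hi _ hx) p
      exact (ContDiffAt.comp (f := fun y : ℝ × (E × (E →L[ℝ] ℝ)) ↦ y.2) (s, (x, p)) this
        contDiffAt_snd).contDiffWithinAt
    have := ODE.contDiffOn_enat_Icc_of_hasDerivWithinAt (n := ⊤) hf (α := z)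
      (fun s hs ↦ (hd s (hsub hs)).2.hasDerivWithinAt) (fun s hs ↦ ⟨(hd s (hsub hs)).1, mem_univ _⟩)
    exact this.contDiffAt (Icc_mem_nhds h1' h2)
  refine ⟨fun t ↦ (z t).1, by simp [hz, hα0], ?_, fun t ht ↦ ⟨(hd t ht).1, ?_, ?_⟩⟩
  · rw [(hasDerivAt_fst_comp (hd 0 h0mem).2).deriv, hz]
    simp only [hα0, hamiltonField]
    exact (hi _ hqU).inverse_apply_self _
  · exact contDiffAt_fst.comp t (hsmooth t ht)
  · apply isCoordGeodesicAt_of_hamiltonField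
    filter_upwards [Ioo_mem_nhds ht.1 ht.2] with s hs
    exact ⟨hi _ (hd s hs).1, (hd s hs).2⟩

/-- Conservation of energy along a geodesic. -/
theorem IsCoordGeodesicAt.hasDerivAt_energy {G : E → E →L[ℝ] E →L[ℝ] ℝ} {c : ℝ → E} {t : ℝ}
    (hG : DifferentiableAt ℝ G (c t)) (hsymm : ∀ a b, G (c t) a b = G (c t) b a)
    (hc : ContDiffAt ℝ 2 c t) (h : IsCoordGeodesicAt G c t) :
    HasDerivAt (fun s ↦ G (c s) (deriv c s) (deriv c s)) 0 t := by
  have hd : DifferentiableAt ℝ c t := hc.differentiableAt (by simp)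
  have hdd : DifferentiableAt ℝ (deriv c) t :=
    (hc.derivWithin (m := 1) (by norm_num)).differentiableAt (by simp)
  -- The derivative of the energy is computed twice: from the geodesic equation for the momentum,
  -- and by the product rule for `G`. Comparing the two shows that it vanishes.
  have h1 := h.clm_apply hdd.hasDerivAt
  have h2 := ((hG.hasFDerivAt.comp_hasDerivAt t hd.hasDerivAt).clm_apply
    hdd.hasDerivAt).clm_apply hdd.hasDerivAt
  have h3 := h1.unique h2
  simp only [lagrangeForce_apply, Function.comp, _root_.add_apply] at h3 
  rw [hsymm (deriv (deriv c) t)] at h3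
  have h4 : lagrangeForce G (c t) (deriv c t) (deriv c t) +
      G (c t) (deriv c t) (deriv (deriv c) t) = 0 := by
    rw [lagrangeForce_apply]
    linarith
  rwa [h4] at h1

/-- The geodesic equation does not depend on the coordinates. -/
theorem IsCoordGeodesicAt.of_pullback {G G' : E → E →L[ℝ] E →L[ℝ] ℝ} {φ : E → E} {c : ℝ → E}
    {t : ℝ} (hφ : ContDiffAt ℝ ∞ φ (c t)) (hc : ContDiffAt ℝ ∞ c t)
    (hG : DifferentiableAt ℝ G (c t)) (hG' : DifferentiableAt ℝ G' (φ (c t)))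
    (hsymm : ∀ a b, G' (φ (c t)) a b = G' (φ (c t)) b a)
    (hpull : ∀ᶠ x in 𝓝 (c t), ∀ a b, G x a b = G' (φ x) (fderiv ℝ φ x a) (fderiv ℝ φ x b))
    (h : IsCoordGeodesicAt G' (φ ∘ c) t) : IsCoordGeodesicAt G c t := by
  have hcd : DifferentiableAt ℝ c t := hc.differentiableAt (by simp)
  have hφd : DifferentiableAt ℝ φ (c t) := hφ.differentiableAt (by simp)
  have hDφ : DifferentiableAt ℝ (fderiv ℝ φ) (c t) :=
    (hφ.fderiv_right (m := 1) (by norm_cast)).differentiableAt (by simp)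
  have hderiv : ∀ᶠ s in 𝓝 t, deriv (φ ∘ c) s = fderiv ℝ φ (c s) (deriv c s) := by
    have h1 : ∀ᶠ s in 𝓝 t, ContDiffAt ℝ 1 c s := (hc.of_le (by simp)).eventually (by simp)
    have h2 : ∀ᶠ s in 𝓝 t, ContDiffAt ℝ 1 φ (c s) :=
      hcd.continuousAt.eventually ((hφ.of_le (by simp)).eventually (by simp))
    filter_upwards [h1, h2] with s hs1 hs2
    exact fderiv_comp_deriv s (hs2.differentiableAt (by simp)) (hs1.differentiableAt (by simp))
  -- Momenta are covectors, so they pull back by the transpose of the derivative of `φ`.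
  have heq : (fun s ↦ G (c s) (deriv c s)) =ᶠ[𝓝 t] fun s ↦
      (G' ((φ ∘ c) s) (deriv (φ ∘ c) s)).comp (fderiv ℝ φ (c s)) := by
    filter_upwards [hderiv, hcd.continuousAt.eventually hpull] with s hs1 hs2
    ext ξ
    simp [hs1, hs2]
  have hD : HasDerivAt (fun s ↦ fderiv ℝ φ (c s)) (fderiv ℝ (fderiv ℝ φ) (c t) (deriv c t)) t :=
    hDφ.hasFDerivAt.comp_hasDerivAt t hcd.hasDerivAt
  have hmain := (HasDerivAt.clm_comp h hD).congr_of_eventuallyEq heq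
  suffices hF : lagrangeForce G (c t) (deriv c t) =
      (lagrangeForce G' ((φ ∘ c) t) (deriv (φ ∘ c) t)).comp (fderiv ℝ φ (c t)) +
        (G' ((φ ∘ c) t) (deriv (φ ∘ c) t)).comp (fderiv ℝ (fderiv ℝ φ) (c t) (deriv c t)) by
    unfold IsCoordGeodesicAt
    rw [hF]
    exact hmain
  ext ξ
  set a := deriv c t
  have hf1 : HasFDerivAt (fun x ↦ G x a a) _ (c t) :=
    (hG.hasFDerivAt.clm_apply (hasFDerivAt_const a (c t))).clm_apply (hasFDerivAt_const a (c t))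
  have hDa := hDφ.hasFDerivAt.clm_apply (hasFDerivAt_const a (c t))
  have hf2 := ((hG'.hasFDerivAt.comp (c t) hφd.hasFDerivAt).clm_apply hDa).clm_apply hDa
  have hf3 := hf1.unique (hf2.congr_of_eventuallyEq (by
    filter_upwards [hpull] with x hx
    exact hx a a))
  have hf4 := congrArg (fun L : E →L[ℝ] ℝ ↦ L ξ) hf3
  -- Differentiating the pullback formula in the direction `ξ` produces `D²φ(ξ, a)`, while
  -- differentiating the momentum along the curve produces `D²φ(a, ξ)`. Symmetry of the second
  -- derivative reconciles them.
  have hsnd : fderiv ℝ (fderiv ℝ φ) (c t) ξ a = fderiv ℝ (fderiv ℝ φ) (c t) a ξ :=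
    (hφ.isSymmSndFDerivAt (by simp; norm_cast)) ξ a
  simp at hf4
  rw [hsymm (fderiv ℝ (fderiv ℝ φ) (c t) ξ a), hsnd] at hf4
  simp only [lagrangeForce_apply, _root_.add_apply, ContinuousLinearMap.comp_apply]
  rw [hf4, hderiv.self_of_nhds]
  simp only [Function.comp]
  ring

end CoordinateGeodesics

/-! ### The Riemannian metric in charts -/

section MetricInCharts

set_option maxSynthPendingDepth 3

variable {M : Type*} [TopologicalSpace M] [ChartedSpace Plane M]

theorem mdifferentiableAt_chart {e : OpenPartialHomeomorph M Plane}
    (he : e ∈ IsManifold.maximalAtlas (𝓡 2) ∞ M) {p : M} (hp : p ∈ e.source) :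
    MDifferentiableAt (𝓡 2) (𝓡 2) e p :=
  (contMDiffAt_of_mem_maximalAtlas he hp).mdifferentiableAt (by simp)

theorem mdifferentiableAt_chart_symm {e : OpenPartialHomeomorph M Plane}
    (he : e ∈ IsManifold.maximalAtlas (𝓡 2) ∞ M) {x : Plane} (hx : x ∈ e.target) :
    MDifferentiableAt (𝓡 2) (𝓡 2) e.symm x :=
  (contMDiffAt_symm_of_mem_maximalAtlas he hx).mdifferentiableAt (by simp)

/-- The derivative of the inverse of a chart, as a map of the model spaces. -/
def chartSymmDeriv (e : OpenPartialHomeomorph M Plane) (x : Plane) : Plane →L[ℝ] Plane :=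
  mfderiv (𝓡 2) (𝓡 2) e.symm x

theorem chartSymmDeriv_injective {e : OpenPartialHomeomorph M Plane}
    (he : e ∈ IsManifold.maximalAtlas (𝓡 2) ∞ M) {x : Plane} (hx : x ∈ e.target) :
    Function.Injective (chartSymmDeriv e x) := by
  have h1 : MDifferentiableAt (𝓡 2) (𝓡 2) e (e.symm x) :=
    mdifferentiableAt_chart he (e.map_target hx)
  have h2 := mfderiv_comp x h1 (mdifferentiableAt_chart_symm he hx)
  have h3 : (e ∘ e.symm) =ᶠ[𝓝 x] id := by
    filter_upwards [e.open_target.mem_nhds hx] with y hy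
    exact e.right_inv hy
  rw [h3.mfderiv_eq] at h2
  refine Function.LeftInverse.injective (g := mfderiv (𝓡 2) (𝓡 2) e (e.symm x)) fun a ↦ ?_
  have h4 := congrArg (fun L : Plane →L[ℝ] Plane ↦ L a) h2
  have h5 : (mfderiv (𝓡 2) (𝓡 2) (id : Plane → Plane) x : Plane →L[ℝ] Plane) a = a := by
    rw [mfderiv_id]; rfl
  exact h4.symm.trans h5

theorem contMDiffOn_pushforward [IsManifold (𝓡 2) ∞ M] {f : Plane → M} {s : Set Plane} (hs : IsOpen s)
    (hf : ContMDiffOn (𝓡 2) (𝓡 2) ∞ f s) (a : Plane) :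
    ContMDiffOn (𝓡 2) (𝓡 2).tangent ∞
      (fun x : Plane ↦ (⟨f x, mfderiv (𝓡 2) (𝓡 2) f x a⟩ : TangentBundle (𝓡 2) M)) s := by
  have h1 := hf.contMDiffOn_tangentMapWithin (m := ∞) (by simp) hs.uniqueMDiffOn
  have h2 : ContMDiffOn (𝓡 2) (𝓡 2).tangent ∞
      (fun x : Plane ↦ (⟨x, a⟩ : TangentBundle (𝓡 2) Plane)) s :=
    contMDiffOn_vectorSpace_iff_contDiffOn.2 contDiffOn_const
  refine (h1.comp h2 (fun x hx ↦ hx)).congr fun x hx ↦ ?_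
  simp [tangentMapWithin, mfderivWithin_of_mem_nhds (hs.mem_nhds hx)]

variable [RiemannianBundle (fun x : M ↦ TangentSpace (𝓡 2) x)]

/-- The Riemannian metric at `p`, as a form on the model space of the tangent space. -/
def metricAt (p : M) (a b : Plane) : ℝ :=
  inner (E := TangentSpace (𝓡 2) p) ℝ a b

theorem chartMetric_eq_metricAt (e : OpenPartialHomeomorph M Plane) (x a b : Plane) :
    chartMetric e x a b = metricAt (e.symm x) (chartSymmDeriv e x a) (chartSymmDeriv e x b) :=
  rfl

theorem metricAt_self (p : M) (a : Plane) :
    metricAt p a a = norm (E := TangentSpace (𝓡 2) p) a ^ 2 :=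
  real_inner_self_eq_norm_sq (F := TangentSpace (𝓡 2) p) a

theorem metricAt_comm (p : M) (a b : Plane) : metricAt p a b = metricAt p b a :=
  real_inner_comm (F := TangentSpace (𝓡 2) p) b a

theorem metricAt_self_pos (p : M) {a : Plane} (ha : a ≠ 0) : 0 < metricAt p a a := by
  rw [metricAt_self]
  exact pow_pos (norm_pos_iff (E := TangentSpace (𝓡 2) p).2 ha) 2

/-- The metric at `p`, as a continuous bilinear form. -/
def metricFormAt (p : M) : Plane →L[ℝ] Plane →L[ℝ] ℝ :=
  (innerSL ℝ : TangentSpace (𝓡 2) p →L[ℝ] TangentSpace (𝓡 2) p →L[ℝ] ℝ)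

theorem metricFormAt_apply (p : M) (a b : Plane) : metricFormAt p a b = metricAt p a b := rfl

/-- The coefficients of the metric in a chart, as a continuous bilinear form. -/
def metricForm (e : OpenPartialHomeomorph M Plane) (x : Plane) : Plane →L[ℝ] Plane →L[ℝ] ℝ :=
  (metricFormAt (e.symm x)).bilinearComp (chartSymmDeriv e x) (chartSymmDeriv e x)

theorem metricForm_apply (e : OpenPartialHomeomorph M Plane) (x a b : Plane) :
    metricForm e x a b = chartMetric e x a b := rfl

theorem metricForm_comm (e : OpenPartialHomeomorph M Plane) (x a b : Plane) :
    metricForm e x a b = metricForm e x b a := by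
  simp only [metricForm_apply, chartMetric_eq_metricAt]
  exact metricAt_comm _ _ _

theorem metricForm_self_pos {e : OpenPartialHomeomorph M Plane}
    (he : e ∈ IsManifold.maximalAtlas (𝓡 2) ∞ M) {x : Plane} (hx : x ∈ e.target) {a : Plane}
    (ha : a ≠ 0) : 0 < metricForm e x a a := by
  rw [metricForm_apply, chartMetric_eq_metricAt]
  apply metricAt_self_pos
  rwa [Ne, ← map_zero (chartSymmDeriv e x), (chartSymmDeriv_injective he hx).eq_iff]

theorem metricForm_isInvertible {e : OpenPartialHomeomorph M Plane}
    (he : e ∈ IsManifold.maximalAtlas (𝓡 2) ∞ M) {x : Plane} (hx : x ∈ e.target) :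
    (metricForm e x).IsInvertible := by
  have hinj : Function.Injective (metricForm e x : Plane →ₗ[ℝ] Plane →L[ℝ] ℝ) := by
    rw [injective_iff_map_eq_zero]
    intro a ha
    by_contra h
    have h1 : metricForm e x a = 0 := ha
    have := metricForm_self_pos he hx h
    rw [h1] at this
    simp at this
  have hdim : Module.finrank ℝ Plane = Module.finrank ℝ (Plane →L[ℝ] ℝ) := by
    rw [← (LinearMap.toContinuousLinearMap (𝕜 := ℝ) (E := Plane) (F' := ℝ)).finrank_eq]
    exact (Subspace.dual_finrank_eq).symm
  refine ⟨(LinearEquiv.ofInjectiveOfFinrankEq _ hinj hdim).toContinuousLinearEquiv, ?_⟩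
  ext a b
  rfl

theorem contDiffOn_metricForm [IsManifold (𝓡 2) ∞ M]
    [IsContMDiffRiemannianBundle (𝓡 2) ∞ Plane (fun x : M ↦ TangentSpace (𝓡 2) x)]
    {e : OpenPartialHomeomorph M Plane} (he : e ∈ IsManifold.maximalAtlas (𝓡 2) ∞ M) :
    ContDiffOn ℝ ∞ (metricForm e) e.target := by
  rw [contDiffOn_clm_apply]
  intro a
  rw [contDiffOn_clm_apply]
  intro b
  have key : ∀ a : Plane, ContMDiffOn (𝓡 2) (𝓡 2).tangent ∞
      (fun x : Plane ↦ (⟨e.symm x, mfderiv (𝓡 2) (𝓡 2) e.symm x a⟩ : TangentBundle (𝓡 2) M))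
      e.target := by
    exact fun a ↦ contMDiffOn_pushforward e.open_target
      (contMDiffOn_symm_of_mem_maximalAtlas he) a
  have := ContMDiffOn.inner_bundle (key a) (key b)
  rw [contMDiffOn_iff_contDiffOn] at this
  exact this

/-- The metric forms in two charts are related by the transition map. -/
theorem metricForm_transition {e e' : OpenPartialHomeomorph M Plane}
    (he : e ∈ IsManifold.maximalAtlas (𝓡 2) ∞ M) (he' : e' ∈ IsManifold.maximalAtlas (𝓡 2) ∞ M)
    {x : Plane} (hx : x ∈ e.target) (hx' : e.symm x ∈ e'.source) (a b : Plane) :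
    metricForm e x a b = metricForm e' (e' (e.symm x)) (fderiv ℝ (e' ∘ e.symm) x a)
      (fderiv ℝ (e' ∘ e.symm) x b) := by
  have hφ : MDifferentiableAt (𝓡 2) (𝓡 2) (e' ∘ e.symm) x :=
    (mdifferentiableAt_chart he' hx').comp x (mdifferentiableAt_chart_symm he hx)
  have h1 : e.symm =ᶠ[𝓝 x] e'.symm ∘ (e' ∘ e.symm) := by
    filter_upwards [(e.continuousAt_symm hx).eventually_mem (e'.open_source.mem_nhds hx')]
      with y hy
    exact (e'.left_inv hy).symm
  have h2 : chartSymmDeriv e x =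
      (chartSymmDeriv e' (e' (e.symm x))).comp (fderiv ℝ (e' ∘ e.symm) x) := by
    have h3 := mfderiv_comp x
      (mdifferentiableAt_chart_symm he' (e'.map_source hx') :
        MDifferentiableAt (𝓡 2) (𝓡 2) e'.symm ((e' ∘ e.symm) x)) hφ
    rw [← h1.mfderiv_eq] at h3
    rw [mfderiv_eq_fderiv] at h3
    exact h3
  simp only [metricForm_apply, chartMetric_eq_metricAt, h2, e'.left_inv hx']
  rfl

end MetricInCharts

/-! ### Reparametrizations of coordinate geodesics -/

section CoordReparam
set_option maxSynthPendingDepth 3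

theorem hasDerivAt_affine (σ a t : ℝ) : HasDerivAt (fun s : ℝ ↦ σ * s + a) σ t := by
  simpa using ((hasDerivAt_id t).const_mul σ).add_const a

/-- Translations in time and time reversal preserve the geodesic equation. -/
theorem IsCoordGeodesicAt.comp_affine {E : Type*} [NormedAddCommGroup E] [NormedSpace ℝ E]
    {G : E → E →L[ℝ] E →L[ℝ] ℝ} {c : ℝ → E} {σ a t : ℝ} (hσ : σ * σ = 1)
    (hc : ∀ᶠ s in 𝓝 (σ * t + a), DifferentiableAt ℝ c s)
    (h : IsCoordGeodesicAt G c (σ * t + a)) :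
    IsCoordGeodesicAt G (fun s ↦ c (σ * s + a)) t := by
  have hd : ∀ᶠ s in 𝓝 t, deriv (fun s ↦ c (σ * s + a)) s = σ • deriv c (σ * s + a) := by
    have := (hasDerivAt_affine σ a t).continuousAt.eventually hc
    filter_upwards [this] with s hs
    exact (hs.hasDerivAt.scomp s (hasDerivAt_affine σ a s)).deriv
  have h0 : HasDerivAt (fun s ↦ G (c s) (deriv c s))
      (lagrangeForce G (c (σ * t + a)) (deriv c (σ * t + a))) (σ * t + a) := h
  have h1 := (HasDerivAt.scomp t h0 (hasDerivAt_affine σ a t)).const_smul σ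
  have h2 : (fun s ↦ G (c (σ * s + a)) (deriv (fun s ↦ c (σ * s + a)) s)) =ᶠ[𝓝 t]
      σ • ((fun s ↦ G (c s) (deriv c s)) ∘ fun s ↦ σ * s + a) := by
    filter_upwards [hd] with s hs
    simp [hs]
  have h3 : lagrangeForce G (c (σ * t + a)) (deriv (fun s ↦ c (σ * s + a)) t) =
      σ • σ • lagrangeForce G (c (σ * t + a)) (deriv c (σ * t + a)) := by
    ext ξ
    rw [hd.self_of_nhds, smul_smul, hσ, one_smul, lagrangeForce_apply, lagrangeForce_apply]
    simp only [map_smul, _root_.smul_apply, smul_eq_mul]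
    rw [← mul_assoc σ σ, hσ, one_mul]
  unfold IsCoordGeodesicAt
  rw [h3]
  exact h1.congr_of_eventuallyEq h2

theorem IsCoordGeodesicAt.congr {E : Type*} [NormedAddCommGroup E] [NormedSpace ℝ E]
    {G : E → E →L[ℝ] E →L[ℝ] ℝ} {c c' : ℝ → E} {t : ℝ} (h : IsCoordGeodesicAt G c t)
    (hcc : c' =ᶠ[𝓝 t] c) : IsCoordGeodesicAt G c' t := by
  have h1 := hcc.deriv
  unfold IsCoordGeodesicAt
  rw [h1.self_of_nhds, hcc.self_of_nhds]
  refine HasDerivAt.congr_of_eventuallyEq h ?_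
  filter_upwards [hcc, h1] with s hs hs1
  rw [hs, hs1]

end CoordReparam

/-! ### Velocities and geodesics on the surface -/

section Geodesics

variable {M : Type*} [TopologicalSpace M] [ChartedSpace Plane M]

theorem velocity_congr {γ γ' : ℝ → M} {t : ℝ} (h : γ =ᶠ[𝓝 t] γ') :
    velocity γ t = velocity γ' t := by
  have h1 : mfderiv 𝓘(ℝ, ℝ) (𝓡 2) γ t = mfderiv 𝓘(ℝ, ℝ) (𝓡 2) γ' t := h.mfderiv_eq
  unfold velocity
  have h2 := h.self_of_nhds
  refine TotalSpace.ext h2 ?_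
  exact heq_of_eq (congrArg (fun L : ℝ →L[ℝ] Plane ↦ L 1) h1)

theorem differentiableAt_chart_comp {γ : ℝ → M} {t : ℝ}
    (hγ : MDifferentiableAt 𝓘(ℝ, ℝ) (𝓡 2) γ t) {e : OpenPartialHomeomorph M Plane}
    (he : e ∈ IsManifold.maximalAtlas (𝓡 2) ∞ M) (ht : γ t ∈ e.source) :
    DifferentiableAt ℝ (fun s ↦ e (γ s)) t :=
  ((mdifferentiableAt_chart he ht).comp t hγ).differentiableAt

theorem deriv_chart_comp {γ : ℝ → M} {t : ℝ}
    (hγ : MDifferentiableAt 𝓘(ℝ, ℝ) (𝓡 2) γ t) {e : OpenPartialHomeomorph M Plane}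
    (he : e ∈ IsManifold.maximalAtlas (𝓡 2) ∞ M) (ht : γ t ∈ e.source) :
    deriv (fun s ↦ e (γ s)) t = mfderiv (𝓡 2) (𝓡 2) e (γ t) (velocity γ t).2 := by
  have h := mfderiv_comp t (mdifferentiableAt_chart he ht) hγ
  rw [mfderiv_eq_fderiv] at h
  exact congrArg (fun L : ℝ →L[ℝ] Plane ↦ L 1) h

theorem velocity_snd_eq {γ : ℝ → M} {t : ℝ}
    (hγ : MDifferentiableAt 𝓘(ℝ, ℝ) (𝓡 2) γ t) {e : OpenPartialHomeomorph M Plane}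
    (he : e ∈ IsManifold.maximalAtlas (𝓡 2) ∞ M) (ht : γ t ∈ e.source) :
    (velocity γ t).2 = chartSymmDeriv e (e (γ t)) (deriv (fun s ↦ e (γ s)) t) := by
  have h1 : γ =ᶠ[𝓝 t] e.symm ∘ (fun s ↦ e (γ s)) := by
    filter_upwards [hγ.continuousAt.eventually_mem (e.open_source.mem_nhds ht)] with s hs
    exact (e.left_inv hs).symm
  have h2 := mfderiv_comp t (mdifferentiableAt_chart_symm he (e.map_source ht))
    (differentiableAt_chart_comp hγ he ht).mdifferentiableAt
  rw [← h1.mfderiv_eq, mfderiv_eq_fderiv] at h2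
  exact congrArg (fun L : ℝ →L[ℝ] Plane ↦ L 1) h2

theorem contDiffAt_chart_comp {γ : ℝ → M} {t : ℝ}
    (hγ : ContMDiffAt 𝓘(ℝ, ℝ) (𝓡 2) ∞ γ t) {e : OpenPartialHomeomorph M Plane}
    (he : e ∈ IsManifold.maximalAtlas (𝓡 2) ∞ M) (ht : γ t ∈ e.source) :
    ContDiffAt ℝ ∞ (fun s ↦ e (γ s)) t :=
  ((contMDiffAt_of_mem_maximalAtlas he ht).comp t hγ).contDiffAt

theorem velocity_comp_affine {γ : ℝ → M} {σ a t : ℝ}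
    (hγ : MDifferentiableAt 𝓘(ℝ, ℝ) (𝓡 2) γ (σ * t + a)) :
    velocity (fun s ↦ γ (σ * s + a)) t =
      ⟨γ (σ * t + a), σ • (velocity γ (σ * t + a)).2⟩ := by
  have h1 := (hasDerivAt_affine σ a t)
  have h2 := mfderiv_comp t hγ h1.differentiableAt.mdifferentiableAt
  rw [mfderiv_eq_fderiv] at h2
  have h3 := congrArg (fun L : ℝ →L[ℝ] Plane ↦ L 1) h2
  refine TotalSpace.ext rfl (heq_of_eq ?_)
  refine h3.trans ?_
  have h4 : (fderiv ℝ (fun s : ℝ ↦ σ * s + a) t) 1 = σ := h1.deriv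
  have h5 : ∀ L : ℝ →L[ℝ] Plane, L σ = σ • L 1 := fun L ↦ by rw [← map_smul]; simp
  refine Eq.trans ?_ (h5 _)
  exact congrArg (fun r ↦ (mfderiv 𝓘(ℝ, ℝ) (𝓡 2) γ (σ * t + a) : ℝ →L[ℝ] Plane) r) h4

variable [RiemannianBundle (fun x : M ↦ TangentSpace (𝓡 2) x)]

theorem metricForm_chart_velocity {γ : ℝ → M} {t : ℝ}
    (hγ : MDifferentiableAt 𝓘(ℝ, ℝ) (𝓡 2) γ t) {e : OpenPartialHomeomorph M Plane}
    (he : e ∈ IsManifold.maximalAtlas (𝓡 2) ∞ M) (ht : γ t ∈ e.source) :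
    metricForm e (e (γ t)) (deriv (fun s ↦ e (γ s)) t) (deriv (fun s ↦ e (γ s)) t) =
      ‖(velocity γ t).2‖ ^ 2 := by
  rw [metricForm_apply, chartMetric_eq_metricAt, ← velocity_snd_eq hγ he ht, e.left_inv ht]
  exact metricAt_self _ _

/-- The curve `γ` is smooth, has unit speed, and satisfies the geodesic equation at time `t`. -/
structure IsGeodesicAt (γ : ℝ → M) (t : ℝ) : Prop where
  smooth : ContMDiffAt 𝓘(ℝ, ℝ) (𝓡 2) ∞ γ t
  unit_speed : ‖(velocity γ t).2‖ = 1
  coord : ∀ e ∈ IsManifold.maximalAtlas (𝓡 2) ∞ M, γ t ∈ e.source →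
    IsCoordGeodesicAt (metricForm e) (fun s ↦ e (γ s)) t

theorem IsGeodesicAt.mdifferentiableAt {γ : ℝ → M} {t : ℝ} (h : IsGeodesicAt γ t) :
    MDifferentiableAt 𝓘(ℝ, ℝ) (𝓡 2) γ t :=
  h.smooth.mdifferentiableAt (by simp)

theorem norm_snd_congr {p q : TangentBundle (𝓡 2) M} (h : p = q) : ‖p.2‖ = ‖q.2‖ := by rw [h]

theorem IsGeodesicAt.congr {γ γ' : ℝ → M} {t : ℝ} (h : IsGeodesicAt γ t) (hγ : γ' =ᶠ[𝓝 t] γ) :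
    IsGeodesicAt γ' t where
  smooth := h.smooth.congr_of_eventuallyEq hγ
  unit_speed := by rw [norm_snd_congr (velocity_congr hγ), h.unit_speed]
  coord e he ht := by
    rw [hγ.self_of_nhds] at ht
    exact (h.coord e he ht).congr (hγ.fun_comp e)

theorem IsGeodesicAt.comp_affine {γ : ℝ → M} {σ a t : ℝ} (hσ : σ * σ = 1)
    (h : IsGeodesicAt γ (σ * t + a)) (hd : ∀ᶠ s in 𝓝 (σ * t + a), IsGeodesicAt γ s) :
    IsGeodesicAt (fun s ↦ γ (σ * s + a)) t where
  smooth := by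
    have : ContDiff ℝ ∞ (fun s : ℝ ↦ σ * s + a) := by fun_prop
    exact h.smooth.comp t this.contMDiff.contMDiffAt
  unit_speed := by
    have hσ' : ‖σ‖ = 1 := by
      rw [Real.norm_eq_abs, ← sq_eq_sq₀ (abs_nonneg σ) (by norm_num), sq_abs, sq, hσ]
      norm_num
    refine (norm_snd_congr (velocity_comp_affine h.mdifferentiableAt)).trans ?_
    refine (norm_smul σ (velocity γ (σ * t + a)).2).trans ?_
    rw [hσ', h.unit_speed, one_mul]
  coord e he ht := by
    refine IsCoordGeodesicAt.comp_affine (c := fun s ↦ e (γ s)) hσ ?_ (h.coord e he ht)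
    filter_upwards [hd, h.smooth.continuousAt.eventually_mem (e.open_source.mem_nhds ht)] with s h1 h2
    exact differentiableAt_chart_comp h1.mdifferentiableAt he h2

end Geodesics

/-! ### Independence of the chart, local existence and uniqueness -/

section GeodesicTheory

set_option maxSynthPendingDepth 3

variable {M : Type*} [TopologicalSpace M] [ChartedSpace Plane M]

theorem coord_eq_of_velocity_eq {γ₁ γ₂ : ℝ → M} {t : ℝ} (h : velocity γ₁ t = velocity γ₂ t)
    (h₁ : MDifferentiableAt 𝓘(ℝ, ℝ) (𝓡 2) γ₁ t) (h₂ : MDifferentiableAt 𝓘(ℝ, ℝ) (𝓡 2) γ₂ t)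
    {e : OpenPartialHomeomorph M Plane} (he : e ∈ IsManifold.maximalAtlas (𝓡 2) ∞ M)
    (ht : γ₁ t ∈ e.source) : γ₁ t = γ₂ t ∧
      deriv (fun s ↦ e (γ₁ s)) t = deriv (fun s ↦ e (γ₂ s)) t := by
  have h0 : γ₁ t = γ₂ t := congrArg TotalSpace.proj h
  refine ⟨h0, ?_⟩
  rw [deriv_chart_comp h₁ he ht, deriv_chart_comp h₂ he (h0 ▸ ht)]
  have key : ∀ p q : TangentBundle (𝓡 2) M, p = q →
      (mfderiv (𝓡 2) (𝓡 2) e p.1 p.2 : Plane) = mfderiv (𝓡 2) (𝓡 2) e q.1 q.2 := by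
    rintro p _ rfl
    rfl
  exact key _ _ h

variable [IsManifold (𝓡 2) ∞ M]
  [RiemannianBundle (fun x : M ↦ TangentSpace (𝓡 2) x)]
  [IsContMDiffRiemannianBundle (𝓡 2) ∞ Plane (fun x : M ↦ TangentSpace (𝓡 2) x)]

theorem contDiffAt_metricForm {e : OpenPartialHomeomorph M Plane}
    (he : e ∈ IsManifold.maximalAtlas (𝓡 2) ∞ M) {x : Plane} (hx : x ∈ e.target) :
    ContDiffAt ℝ ∞ (metricForm e) x :=
  (contDiffOn_metricForm he).contDiffAt (e.open_target.mem_nhds hx)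

theorem differentiableAt_metricForm {e : OpenPartialHomeomorph M Plane}
    (he : e ∈ IsManifold.maximalAtlas (𝓡 2) ∞ M) {x : Plane} (hx : x ∈ e.target) :
    DifferentiableAt ℝ (metricForm e) x :=
  (contDiffAt_metricForm he hx).differentiableAt (by simp)

theorem lagrangeForce_metricForm {e : OpenPartialHomeomorph M Plane}
    (he : e ∈ IsManifold.maximalAtlas (𝓡 2) ∞ M) {x : Plane} (hx : x ∈ e.target) (a ξ : Plane) :
    lagrangeForce (metricForm e) x a ξ =
      1 / 2 * fderiv ℝ (fun x ↦ chartMetric e x a a) x ξ := by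
  have h := ((differentiableAt_metricForm he hx).hasFDerivAt.clm_apply
    (hasFDerivAt_const a x)).clm_apply (hasFDerivAt_const a x)
  have h' : HasFDerivAt (fun x ↦ chartMetric e x a a) _ x := h
  rw [lagrangeForce_apply, h'.fderiv]
  simp

/-- The definition tests the equation on one constant vector `ξ` at a time. Smoothness of the curve
and of the metric makes the momentum differentiable as a curve of covectors, so the tests combine
into a single equation. -/
theorem isUnitSpeedGeodesic_iff {γ : ℝ → M} :
    IsUnitSpeedGeodesic γ ↔ ∀ t, IsGeodesicAt γ t := by
  constructor
  · intro h t
    refine ⟨h.smooth.contMDiffAt, h.unit_speed t, fun e he ht ↦ ?_⟩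
    have hc := contDiffAt_chart_comp h.smooth.contMDiffAt he ht
    have hd : DifferentiableAt ℝ (fun s ↦ e (γ s)) t := hc.differentiableAt (by simp)
    have hdd : DifferentiableAt ℝ (deriv (fun s ↦ e (γ s))) t :=
      (hc.derivWithin (m := 1) (by norm_cast)).differentiableAt (by simp)
    have hG : DifferentiableAt ℝ (fun s ↦ metricForm e (e (γ s))) t :=
      DifferentiableAt.comp (g := metricForm e) t
        (differentiableAt_metricForm he (e.map_source ht)) hd
    have hP := (hG.clm_apply hdd).hasDerivAt
    suffices hF : lagrangeForce (metricForm e) (e (γ t)) (deriv (fun s ↦ e (γ s)) t) =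
        deriv (fun s ↦ metricForm e (e (γ s)) (deriv (fun s ↦ e (γ s)) s)) t by
      unfold IsCoordGeodesicAt
      rw [hF]
      exact hP
    ext ξ
    rw [lagrangeForce_metricForm he (e.map_source ht)]
    refine (h.geodesic_eq e he t ht ξ).unique ?_
    have := hP.clm_apply (hasDerivAt_const t ξ)
    rw [map_zero, add_zero] at this
    exact this
  · intro h
    refine ⟨fun t ↦ (h t).smooth, fun t ↦ (h t).unit_speed, fun e he t ht ξ ↦ ?_⟩
    have h1 := ((h t).coord e he ht).clm_apply (hasDerivAt_const t ξ)
    rw [lagrangeForce_metricForm he (e.map_source ht), map_zero, add_zero] at h1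
    exact h1

/-- The geodesic equation in one chart implies the geodesic equation in every chart. -/
theorem IsCoordGeodesicAt.change_chart {e e' : OpenPartialHomeomorph M Plane}
    (he : e ∈ IsManifold.maximalAtlas (𝓡 2) ∞ M) (he' : e' ∈ IsManifold.maximalAtlas (𝓡 2) ∞ M)
    {γ : ℝ → M} {t : ℝ} (hγ : ContMDiffAt 𝓘(ℝ, ℝ) (𝓡 2) ∞ γ t)
    (ht : γ t ∈ e.source) (ht' : γ t ∈ e'.source)
    (h : IsCoordGeodesicAt (metricForm e') (fun s ↦ e' (γ s)) t) :
    IsCoordGeodesicAt (metricForm e) (fun s ↦ e (γ s)) t := by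
  have hsymm : e.symm (e (γ t)) = γ t := e.left_inv ht
  have hev : ∀ᶠ x in 𝓝 (e (γ t)), x ∈ e.target ∧ e.symm x ∈ e'.source := by
    refine (e.open_target.eventually_mem (e.map_source ht)).and ?_
    refine (e.continuousAt_symm (e.map_source ht)).eventually_mem (e'.open_source.mem_nhds ?_)
    rwa [hsymm]
  have hφ : ContDiffAt ℝ ∞ (e' ∘ e.symm) (e (γ t)) := by
    have h1 : ContMDiffAt (𝓡 2) (𝓡 2) ∞ e' (e.symm (e (γ t))) :=
      contMDiffAt_of_mem_maximalAtlas he' (by rwa [hsymm])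
    exact (h1.comp _ (contMDiffAt_symm_of_mem_maximalAtlas he (e.map_source ht))).contDiffAt
  refine IsCoordGeodesicAt.of_pullback (G' := metricForm e') hφ (contDiffAt_chart_comp hγ he ht)
    (differentiableAt_metricForm he (e.map_source ht)) ?_ (fun a b ↦ metricForm_comm _ _ _ _) ?_ ?_
  · refine differentiableAt_metricForm he' ?_
    simp only [Function.comp, hsymm]
    exact e'.map_source ht'
  · filter_upwards [hev] with x hx a b
    exact metricForm_transition he he' hx.1 hx.2 a b
  · refine h.congr ?_
    filter_upwards [hγ.continuousAt.eventually_mem (e.open_source.mem_nhds ht)] with s hs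
    simp [e.left_inv hs]

theorem isGeodesicAt_of_coord {e : OpenPartialHomeomorph M Plane}
    (he : e ∈ IsManifold.maximalAtlas (𝓡 2) ∞ M) {γ : ℝ → M} {t : ℝ}
    (hγ : ContMDiffAt 𝓘(ℝ, ℝ) (𝓡 2) ∞ γ t) (hu : ‖(velocity γ t).2‖ = 1) (ht : γ t ∈ e.source)
    (h : IsCoordGeodesicAt (metricForm e) (fun s ↦ e (γ s)) t) : IsGeodesicAt γ t :=
  ⟨hγ, hu, fun _ he' ht' ↦ h.change_chart he' he hγ ht' ht⟩

/-- Local existence of geodesics, on a time interval that is uniform in the initial velocity. -/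
theorem exists_isGeodesicAt {e : OpenPartialHomeomorph M Plane}
    (he : e ∈ IsManifold.maximalAtlas (𝓡 2) ∞ M) {x₀ : Plane} (hx₀ : x₀ ∈ e.target) (a₀ : Plane) :
    ∃ ε > 0, ∀ᶠ q : Plane × Plane in 𝓝 (x₀, a₀), metricForm e q.1 q.2 q.2 = 1 →
      ∃ γ : ℝ → M, velocity γ 0 = ⟨e.symm q.1, chartSymmDeriv e q.1 q.2⟩ ∧
        ∀ t ∈ Ioo (-ε) ε, IsGeodesicAt γ t := by
  obtain ⟨ε, hε, h⟩ := exists_isCoordGeodesicAt e.open_target (contDiffOn_metricForm he)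
    (fun x hx ↦ metricForm_isInvertible he hx) hx₀ a₀
  refine ⟨ε, hε, h.mono ?_⟩
  rintro ⟨x, a⟩ ⟨c, hc0, hc0', hc⟩ hxa
  have h0 : (0 : ℝ) ∈ Ioo (-ε) ε := ⟨by linarith, hε⟩
  have hsm : ∀ t ∈ Ioo (-ε) ε, ContMDiffAt 𝓘(ℝ, ℝ) (𝓡 2) ∞ (fun s ↦ e.symm (c s)) t :=
    fun t ht ↦ (contMDiffAt_symm_of_mem_maximalAtlas he (hc t ht).1).comp t
      (hc t ht).2.1.contMDiffAt
  have hmd : ∀ t ∈ Ioo (-ε) ε, MDifferentiableAt 𝓘(ℝ, ℝ) (𝓡 2) (fun s ↦ e.symm (c s)) t :=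
    fun t ht ↦ (hsm t ht).mdifferentiableAt (by simp)
  have hsrc : ∀ t ∈ Ioo (-ε) ε, e.symm (c t) ∈ e.source := fun t ht ↦ e.map_target (hc t ht).1
  have hec : ∀ t ∈ Ioo (-ε) ε, (fun s ↦ e (e.symm (c s))) =ᶠ[𝓝 t] c := by
    intro t ht
    filter_upwards [Ioo_mem_nhds ht.1 ht.2] with s hs
    exact e.right_inv (hc s hs).1
  -- Unit speed is imposed at time `0` only and propagates by conservation of energy.
  have henergy : ∀ t ∈ Ioo (-ε) ε, metricForm e (c t) (deriv c t) (deriv c t) = 1 := by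
    have hder : ∀ t ∈ Ioo (-ε) ε,
        HasDerivAt (fun s ↦ metricForm e (c s) (deriv c s) (deriv c s)) 0 t := fun t ht ↦
      (hc t ht).2.2.hasDerivAt_energy (differentiableAt_metricForm he (hc t ht).1)
        (fun a b ↦ metricForm_comm _ _ _ _) ((hc t ht).2.1.of_le (by norm_cast))
    intro t ht
    have := isOpen_Ioo.is_const_of_deriv_eq_zero isPreconnected_Ioo
      (fun s hs ↦ (hder s hs).differentiableAt.differentiableWithinAt)
      (fun s hs ↦ (hder s hs).deriv) ht h0
    rw [this, hc0, hc0']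
    exact hxa
  have hvel : ∀ t ∈ Ioo (-ε) ε, ‖(velocity (fun s ↦ e.symm (c s)) t).2‖ = 1 := by
    intro t ht
    have := metricForm_chart_velocity (hmd t ht) he (hsrc t ht)
    rw [(hec t ht).deriv_eq, e.right_inv (hc t ht).1, henergy t ht] at this
    exact (pow_eq_one_iff_of_nonneg (norm_nonneg _) two_ne_zero).1 this.symm
  refine ⟨fun s ↦ e.symm (c s), ?_, fun t ht ↦ isGeodesicAt_of_coord he (hsm t ht) (hvel t ht)
    (hsrc t ht) ((hc t ht).2.2.congr (hec t ht))⟩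
  refine TotalSpace.ext (congrArg e.symm hc0) (heq_of_eq ?_)
  refine (velocity_snd_eq (hmd 0 h0) he (hsrc 0 h0)).trans ?_
  rw [(hec 0 h0).deriv_eq, e.right_inv (hc 0 h0).1, hc0, hc0']

/-- A geodesic is locally determined by its velocity at one time. -/
theorem eventuallyEq_of_velocity_eq {γ₁ γ₂ : ℝ → M} {t : ℝ}
    (h : velocity γ₁ t = velocity γ₂ t) (h₁ : ∀ᶠ s in 𝓝 t, IsGeodesicAt γ₁ s)
    (h₂ : ∀ᶠ s in 𝓝 t, IsGeodesicAt γ₂ s) : γ₁ =ᶠ[𝓝 t] γ₂ := by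
  set e := chartAt Plane (γ₁ t) with hedef
  have he : e ∈ IsManifold.maximalAtlas (𝓡 2) ∞ M := IsManifold.chart_mem_maximalAtlas _
  have ht : γ₁ t ∈ e.source := mem_chart_source _ _
  obtain ⟨h0, h0'⟩ := coord_eq_of_velocity_eq h h₁.self_of_nhds.mdifferentiableAt
    h₂.self_of_nhds.mdifferentiableAt he ht
  have hsrc : ∀ γ : ℝ → M, γ t ∈ e.source → (∀ᶠ s in 𝓝 t, IsGeodesicAt γ s) →
      ∀ᶠ s in 𝓝 t, γ s ∈ e.source := fun γ hγ hg ↦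
    hg.self_of_nhds.smooth.continuousAt.eventually_mem (e.open_source.mem_nhds hγ)
  have hco : ∀ γ : ℝ → M, γ t ∈ e.source → (∀ᶠ s in 𝓝 t, IsGeodesicAt γ s) →
      ∀ᶠ s in 𝓝 t, DifferentiableAt ℝ (fun s ↦ e (γ s)) s ∧
        IsCoordGeodesicAt (metricForm e) (fun s ↦ e (γ s)) s := by
    intro γ hγ hg
    filter_upwards [hg, hsrc γ hγ hg] with s h1 h2
    exact ⟨differentiableAt_chart_comp h1.mdifferentiableAt he h2, h1.coord e he h2⟩
  have := eventuallyEq_of_isCoordGeodesicAt e.open_target (contDiffOn_metricForm he)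
    (fun x hx ↦ metricForm_isInvertible he hx) (congrArg e h0) h0' (e.map_source ht)
    (hco γ₁ ht h₁) (hco γ₂ (h0 ▸ ht) h₂)
  filter_upwards [this, hsrc γ₁ ht h₁, hsrc γ₂ (h0 ▸ ht) h₂] with s h1 h2 h3
  exact e.injOn h2 h3 h1

/-- A geodesic is determined by its velocity at one time. -/
theorem eqOn_of_velocity_eq [T2Space M] {γ₁ γ₂ : ℝ → M} {I : Set ℝ} (hI : IsOpen I)
    (hI' : IsPreconnected I) (h₁ : ∀ t ∈ I, IsGeodesicAt γ₁ t) (h₂ : ∀ t ∈ I, IsGeodesicAt γ₂ t)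
    {t₀ : ℝ} (ht₀ : t₀ ∈ I) (h : velocity γ₁ t₀ = velocity γ₂ t₀) : EqOn γ₁ γ₂ I := by
  set u : Set ℝ := {t | t ∈ I ∧ γ₁ =ᶠ[𝓝 t] γ₂} with hu
  have hu_open : IsOpen u := by
    rw [isOpen_iff_mem_nhds]
    rintro t ⟨htI, ht⟩
    exact (hI.eventually_mem htI).and ht.eventuallyEq_nhds
  have hev : ∀ γ : ℝ → M, (∀ t ∈ I, IsGeodesicAt γ t) → ∀ t ∈ I, ∀ᶠ s in 𝓝 t, IsGeodesicAt γ s :=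
    fun γ hγ t ht ↦ (hI.eventually_mem ht).mono hγ
  have hsub : I ⊆ u := by
    refine hI'.subset_of_closure_inter_subset hu_open
      ⟨t₀, ht₀, ht₀, eventuallyEq_of_velocity_eq h (hev _ h₁ _ ht₀) (hev _ h₂ _ ht₀)⟩ ?_
    rintro t ⟨htu, htI⟩
    rw [mem_closure_iff_frequently] at htu
    -- At a limit point of the set of agreement, positions and chart derivatives agree by
    -- continuity, so local uniqueness applies there again.
    refine ⟨htI, eventuallyEq_of_velocity_eq ?_ (hev _ h₁ _ htI) (hev _ h₂ _ htI)⟩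
    have h0 : γ₁ t = γ₂ t := tendsto_nhds_unique_of_frequently_eq
      (h₁ t htI).smooth.continuousAt (h₂ t htI).smooth.continuousAt
      (htu.mono fun s hs ↦ hs.2.self_of_nhds)
    set e := chartAt Plane (γ₁ t) with hedef
    have he : e ∈ IsManifold.maximalAtlas (𝓡 2) ∞ M := IsManifold.chart_mem_maximalAtlas _
    have ht : γ₁ t ∈ e.source := mem_chart_source _ _
    have hcont : ∀ γ : ℝ → M, IsGeodesicAt γ t → γ t ∈ e.source →
        ContinuousAt (deriv (fun s ↦ e (γ s))) t := fun γ hγ hγt ↦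
      ((contDiffAt_chart_comp hγ.smooth he hγt).derivWithin (m := 1) (by norm_cast)).continuousAt
    have h0' : deriv (fun s ↦ e (γ₁ s)) t = deriv (fun s ↦ e (γ₂ s)) t :=
      tendsto_nhds_unique_of_frequently_eq (hcont γ₁ (h₁ t htI) ht) (hcont γ₂ (h₂ t htI) (h0 ▸ ht))
        (htu.mono fun s hs ↦ (hs.2.fun_comp e).deriv_eq)
    refine TotalSpace.ext h0 (heq_of_eq ?_)
    refine (velocity_snd_eq (h₁ t htI).mdifferentiableAt he ht).trans
      (Eq.trans ?_ (velocity_snd_eq (h₂ t htI).mdifferentiableAt he (h0 ▸ ht)).symm)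
    rw [h0', h0]
  exact fun t ht ↦ (hsub ht).2.self_of_nhds

end GeodesicTheory

/-! ### Geodesic completeness and the geodesic flow -/

section Completeness

set_option maxSynthPendingDepth 3

theorem chartSymmDeriv_mfderiv {M : Type*} [TopologicalSpace M] [ChartedSpace Plane M]
    {e : OpenPartialHomeomorph M Plane}
    (he : e ∈ IsManifold.maximalAtlas (𝓡 2) ∞ M) {p : M} (hp : p ∈ e.source)
    (w : TangentSpace (𝓡 2) p) :
    chartSymmDeriv e (e p) (mfderiv (𝓡 2) (𝓡 2) e p w) = w := by
  have h2 := mfderiv_comp p (mdifferentiableAt_chart_symm he (e.map_source hp))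
    (mdifferentiableAt_chart he hp)
  have h3 : (e.symm ∘ e) =ᶠ[𝓝 p] id := by
    filter_upwards [e.open_source.mem_nhds hp] with y hy
    exact e.left_inv hy
  rw [h3.mfderiv_eq] at h2
  have h4 := congrArg (fun L : Plane →L[ℝ] Plane ↦ L w) h2
  have h5 : (mfderiv (𝓡 2) (𝓡 2) (id : M → M) p : Plane →L[ℝ] Plane) w = w := by
    rw [mfderiv_id]; rfl
  exact h4.symm.trans h5

/-- A continuous field of positive definite forms is locally uniformly positive definite. -/
theorem eventually_norm_le_of_posDef {E : Type*} [NormedAddCommGroup E] [NormedSpace ℝ E]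
    [FiniteDimensional ℝ E] {G : E → E →L[ℝ] E →L[ℝ] ℝ} {x₀ : E} (hG : ContinuousAt G x₀)
    (hpos : ∀ a ≠ 0, 0 < G x₀ a a) :
    ∃ R : ℝ, ∀ᶠ x in 𝓝 x₀, ∀ a, G x a a = 1 → ‖a‖ ≤ R := by
  obtain ⟨c, hc, hcG⟩ : ∃ c > 0, ∀ a, ‖a‖ = 1 → c ≤ G x₀ a a := by
    rcases (Metric.sphere (0 : E) 1).eq_empty_or_nonempty with h | h
    · refine ⟨1, one_pos, fun a ha ↦ ?_⟩
      have : a ∈ Metric.sphere (0 : E) 1 := by simpa using ha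
      rw [h] at this
      exact this.elim
    · have hcont : ContinuousOn (fun a ↦ G x₀ a a) (Metric.sphere (0 : E) 1) := by fun_prop
      obtain ⟨a₁, ha₁, hmin⟩ := (isCompact_sphere (0 : E) 1).exists_isMinOn h hcont
      refine ⟨G x₀ a₁ a₁, hpos a₁ ?_, fun a ha ↦ hmin (by simpa using ha)⟩
      rintro rfl
      simp at ha₁
  have hcG' : ∀ a, c * ‖a‖ ^ 2 ≤ G x₀ a a := by
    intro a
    rcases eq_or_ne a 0 with rfl | ha
    · simp
    have hna : ‖a‖ ≠ 0 := norm_ne_zero_iff.2 ha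
    have h1 := hcG (‖a‖⁻¹ • a) (by rw [norm_smul]; simp [hna])
    simp only [map_smul, smul_apply, smul_eq_mul] at h1
    have h2 : ‖a‖⁻¹ * (‖a‖⁻¹ * G x₀ a a) * ‖a‖ ^ 2 = G x₀ a a := by field_simp
    rw [← h2]
    gcongr
  -- A form within `c / 2` of `G x₀` still dominates `c / 2 * ‖a‖ ^ 2`.
  refine ⟨Real.sqrt (2 / c), ?_⟩
  filter_upwards [Metric.tendsto_nhds.1 hG (c / 2) (by positivity)] with x hx a ha
  have h1 : |G x a a - G x₀ a a| ≤ c / 2 * ‖a‖ * ‖a‖ := by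
    have := (G x - G x₀).le_opNorm₂ a a
    rw [dist_eq_norm] at hx
    calc |G x a a - G x₀ a a| = ‖(G x - G x₀) a a‖ := by simp
      _ ≤ _ := this
      _ ≤ _ := by gcongr
  have h2 := hcG' a
  have h3 := abs_le.1 h1
  apply Real.le_sqrt_of_sq_le
  rw [le_div_iff₀ hc]
  nlinarith [h3.1]

variable {M : Type*} [EMetricSpace M] [ChartedSpace Plane M]
  [RiemannianBundle (fun x : M ↦ TangentSpace (𝓡 2) x)]

open Manifold in
/-- Geodesics are `1`-Lipschitz. -/
theorem edist_le_of_isGeodesicAt [IsRiemannianManifold (𝓡 2) M] {γ : ℝ → M} {s t : ℝ}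
    (hst : s ≤ t) (h : ∀ r ∈ Icc s t, IsGeodesicAt γ r) :
    edist (γ s) (γ t) ≤ ENNReal.ofReal (t - s) := by
  rw [IsRiemannianManifold.out (I := 𝓡 2) (γ s) (γ t)]
  have hsm : ContMDiffOn 𝓘(ℝ, ℝ) (𝓡 2) 1 γ (Icc s t) := fun r hr ↦
    ((h r hr).smooth.of_le (by simp)).contMDiffWithinAt
  refine (riemannianEDist_le_pathELength hsm rfl rfl hst).trans ?_
  rw [pathELength_eq_lintegral_mfderiv_Icc]
  have : ∀ r ∈ Icc s t, ‖mfderiv 𝓘(ℝ, ℝ) (𝓡 2) γ r 1‖ₑ = 1 := by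
    intro r hr
    have h1 : ‖mfderiv 𝓘(ℝ, ℝ) (𝓡 2) γ r 1‖ = 1 := (h r hr).unit_speed
    rw [← ofReal_norm, h1, ENNReal.ofReal_one]
  rw [MeasureTheory.setLIntegral_congr_fun measurableSet_Icc this]
  simp

/-- A `1`-Lipschitz curve is Cauchy at a finite end of its interval. -/
theorem exists_tendsto_of_isGeodesicAt [IsRiemannianManifold (𝓡 2) M] [CompleteSpace M]
    {γ : ℝ → M} {a b : ℝ} (hab : a < b) (h : ∀ r ∈ Ioo a b, IsGeodesicAt γ r) :
    ∃ p, Tendsto γ (𝓝[<] b) (𝓝 p) := by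
  have hC : Cauchy (map γ (𝓝[<] b)) := by
    rw [EMetric.cauchy_iff]
    refine ⟨(inferInstance : NeBot (map γ (𝓝[<] b))).ne, fun ε hε ↦ ?_⟩
    obtain ⟨δ, hδ0, hδ⟩ := ENNReal.lt_iff_exists_nnreal_btwn.1 hε
    have hδ0' : (0 : ℝ) < δ := by exact_mod_cast hδ0
    have hm : Ioo (max a (b - δ)) b ∈ 𝓝[<] b :=
      Ioo_mem_nhdsLT (max_lt hab (by linarith))
    refine ⟨γ '' Ioo (max a (b - δ)) b, image_mem_map hm, ?_⟩
    have key : ∀ x ∈ Ioo (max a (b - δ)) b, ∀ y ∈ Ioo (max a (b - δ)) b, x ≤ y →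
        edist (γ x) (γ y) < ε := by
      intro x hx y hy hxy
      refine (edist_le_of_isGeodesicAt hxy fun r hr ↦ h r ?_).trans_lt (lt_of_le_of_lt ?_ hδ)
      · exact ⟨((le_max_left _ _).trans_lt hx.1).trans_le hr.1, hr.2.trans_lt hy.2⟩
      · rw [ENNReal.ofReal_le_iff_le_toReal (by simp)]
        have := (le_max_right a (b - δ)).trans_lt hx.1
        simp only [ENNReal.coe_toReal]
        linarith [hy.2]
    rintro _ ⟨x, hx, rfl⟩ _ ⟨y, hy, rfl⟩
    rcases le_total x y with hxy | hxy
    · exact key x hx y hy hxy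
    · rw [edist_comm]
      exact key y hy x hx hxy
  exact cauchy_iff_exists_le_nhds.1 hC

theorem IsGeodesicAt.comp_shift {M : Type*} [TopologicalSpace M] [ChartedSpace Plane M]
    [RiemannianBundle (fun x : M ↦ TangentSpace (𝓡 2) x)] {γ : ℝ → M} {a t : ℝ}
    (hd : ∀ᶠ s in 𝓝 (t + a), IsGeodesicAt γ s) : IsGeodesicAt (fun s ↦ γ (s + a)) t := by
  have := IsGeodesicAt.comp_affine (γ := γ) (σ := 1) (a := a) (t := t) (by norm_num)
    (by simpa using hd.self_of_nhds) (by simpa using hd)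
  simpa using this

theorem IsGeodesicAt.comp_neg {M : Type*} [TopologicalSpace M] [ChartedSpace Plane M]
    [RiemannianBundle (fun x : M ↦ TangentSpace (𝓡 2) x)] {γ : ℝ → M} {t : ℝ}
    (hd : ∀ᶠ s in 𝓝 (-t), IsGeodesicAt γ s) : IsGeodesicAt (fun s ↦ γ (-s)) t := by
  have := IsGeodesicAt.comp_affine (γ := γ) (σ := -1) (a := 0) (t := t) (by norm_num)
    (by simpa using hd.self_of_nhds) (by simpa using hd)
  simpa using this

theorem velocity_comp_shift {M : Type*} [TopologicalSpace M] [ChartedSpace Plane M]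
    {γ : ℝ → M} {a t : ℝ} (hγ : MDifferentiableAt 𝓘(ℝ, ℝ) (𝓡 2) γ (t + a)) :
    velocity (fun s ↦ γ (s + a)) t = velocity γ (t + a) := by
  have h1 := velocity_comp_affine (γ := γ) (σ := 1) (a := a) (t := t) (by simpa using hγ)
  have h2 : (fun s ↦ γ (1 * s + a)) = fun s ↦ γ (s + a) := by simp
  rw [h2] at h1
  rw [h1, one_mul]
  exact TotalSpace.ext rfl (heq_of_eq (one_smul ℝ (velocity γ (t + a)).2))

variable [IsManifold (𝓡 2) ∞ M]
  [IsContMDiffRiemannianBundle (𝓡 2) ∞ Plane (fun x : M ↦ TangentSpace (𝓡 2) x)]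

/-- By uniqueness the given geodesics agree on common intervals, so their union is well defined. The
value `v.proj` outside of the union plays no role. -/
theorem exists_glue {v : TangentBundle (𝓡 2) M} {S : Set ℝ} (hS : ∀ b ∈ S, ∃ γ : ℝ → M,
    velocity γ 0 = v ∧ ∀ r ∈ Ioo (-b) b, IsGeodesicAt γ r) (hpos : ∃ b ∈ S, 0 < b) :
    ∃ γ : ℝ → M, velocity γ 0 = v ∧ ∀ b ∈ S, ∀ r ∈ Ioo (-b) b, IsGeodesicAt γ r := by
  classical
  have : Nonempty M := ⟨v.proj⟩
  choose! g hg0 hg using hS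
  set γ : ℝ → M := fun t ↦ if h : ∃ b ∈ S, |t| < b then g h.choose t else v.proj with hγdef
  have key : ∀ b ∈ S, EqOn γ (g b) (Ioo (-b) b) := by
    intro b hb t ht
    have h : ∃ b ∈ S, |t| < b := ⟨b, hb, abs_lt.2 ht⟩
    simp only [hγdef, h, dif_pos]
    have hc := h.choose_spec
    set c := h.choose
    have hc' := abs_lt.1 hc.2
    have h0 : 0 < min c b := lt_min ((abs_nonneg t).trans_lt hc.2)
      ((abs_nonneg t).trans_lt (abs_lt.2 ht))
    refine eqOn_of_velocity_eq (I := Ioo (-min c b) (min c b)) (t₀ := 0) isOpen_Ioo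
      isPreconnected_Ioo ?_ ?_ ⟨by linarith, h0⟩ ((hg0 c hc.1).trans (hg0 b hb).symm)
      (abs_lt.1 (lt_min hc.2 (abs_lt.2 ht)))
    · exact fun s hs ↦ hg c hc.1 s (abs_lt.1 ((abs_lt.2 hs).trans_le (min_le_left _ _)))
    · exact fun s hs ↦ hg b hb s (abs_lt.1 ((abs_lt.2 hs).trans_le (min_le_right _ _)))
  have hev : ∀ b ∈ S, ∀ r ∈ Ioo (-b) b, γ =ᶠ[𝓝 r] g b := fun b hb r hr ↦ by
    filter_upwards [Ioo_mem_nhds hr.1 hr.2] with s hs using key b hb hs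
  obtain ⟨b, hb, hb0⟩ := hpos
  refine ⟨γ, ?_, fun b hb r hr ↦ (hg b hb r hr).congr (hev b hb r hr)⟩
  rw [velocity_congr (hev b hb 0 ⟨by linarith, hb0⟩), hg0 b hb]

/-- The geodesic flow moves along geodesics. -/
theorem geodesicFlow_of_velocity_eq {γ : ℝ → M} (hγ : IsUnitSpeedGeodesic γ) {s : ℝ}
    {w : UnitTangentBundle M} (hw : velocity γ s = w.1) (t : ℝ) :
    (geodesicFlow t w).1 = velocity γ (t + s) := by
  have hγ' := isUnitSpeedGeodesic_iff.1 hγ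
  have hsh : IsUnitSpeedGeodesic (fun r ↦ γ (r + s)) := isUnitSpeedGeodesic_iff.2 fun r ↦
    IsGeodesicAt.comp_shift (Eventually.of_forall hγ')
  have hsh0 : velocity (fun r ↦ γ (r + s)) 0 = w.1 := by
    rw [velocity_comp_shift (hγ' _).mdifferentiableAt, zero_add, hw]
  have hex : ∃ γ : ℝ → M, IsUnitSpeedGeodesic γ ∧ velocity γ 0 = w.1 := ⟨_, hsh, hsh0⟩
  have h1 : hex.choose = fun r ↦ γ (r + s) := by
    have := eqOn_of_velocity_eq isOpen_univ isPreconnected_univ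
      (fun t _ ↦ isUnitSpeedGeodesic_iff.1 hex.choose_spec.1 t)
      (fun t _ ↦ isUnitSpeedGeodesic_iff.1 hsh t) (mem_univ 0)
      (hex.choose_spec.2.trans hsh0.symm)
    exact funext fun t ↦ this (mem_univ t)
  unfold geodesicFlow
  rw [dif_pos hex]
  simp only
  rw [h1, velocity_comp_shift (hγ' _).mdifferentiableAt]

variable [IsRiemannianManifold (𝓡 2) M] [CompleteSpace M]

/-- On a complete surface a geodesic can be extended beyond a finite end of its interval. -/
theorem exists_extend_right {γ : ℝ → M} {a b : ℝ} (hab : a < b)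
    (h : ∀ r ∈ Ioo a b, IsGeodesicAt γ r) :
    ∃ b' > b, ∃ γ' : ℝ → M, EqOn γ' γ (Ioo a b) ∧ ∀ r ∈ Ioo a b', IsGeodesicAt γ' r := by
  obtain ⟨p, hp⟩ := exists_tendsto_of_isGeodesicAt hab h
  set e := chartAt Plane p with hedef
  have he : e ∈ IsManifold.maximalAtlas (𝓡 2) ∞ M := IsManifold.chart_mem_maximalAtlas _
  have hpe : p ∈ e.source := mem_chart_source _ _
  have hev : ∀ᶠ t in 𝓝[<] b, γ t ∈ e.source ∧ t ∈ Ioo a b :=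
    (hp.eventually_mem (e.open_source.mem_nhds hpe)).and (Ioo_mem_nhdsLT hab)
  have hx : Tendsto (fun t ↦ e (γ t)) (𝓝[<] b) (𝓝 (e p)) := (e.continuousAt hpe).tendsto.comp hp
  obtain ⟨R, hR⟩ := eventually_norm_le_of_posDef
    (contDiffAt_metricForm he (e.map_source hpe)).continuousAt
    (fun a ha ↦ metricForm_self_pos he (e.map_source hpe) ha)
  have hunit : ∀ᶠ t in 𝓝[<] b, metricForm e (e (γ t)) (deriv (fun s ↦ e (γ s)) t)
      (deriv (fun s ↦ e (γ s)) t) = 1 := by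
    filter_upwards [hev] with t ht
    rw [metricForm_chart_velocity (h t ht.2).mdifferentiableAt he ht.1, (h t ht.2).unit_speed]
    norm_num
  have hbdd : ∀ᶠ t in 𝓝[<] b, deriv (fun s ↦ e (γ s)) t ∈ Metric.closedBall (0 : Plane) R := by
    filter_upwards [hunit, hx.eventually hR] with t h1 h2
    simpa using h2 _ h1
  have hle : map (fun t ↦ deriv (fun s ↦ e (γ s)) t) (𝓝[<] b) ≤
      𝓟 (Metric.closedBall (0 : Plane) R) := le_principal_iff.2 hbdd
  -- Unit speed bounds the coordinate velocities near the limit point. A cluster point `a₀` of them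
  -- is enough: geodesics with data close to `(e p, a₀)` all live for the same time `ε`.
  obtain ⟨a₀, -, ha₀⟩ := (isCompact_closedBall (0 : Plane) R).exists_mapClusterPt hle
  obtain ⟨ε, hε, hgeo⟩ := exists_isGeodesicAt he (e.map_source hpe) a₀
  have hfreq : ∃ᶠ t in 𝓝[<] b, metricForm e (e (γ t)) (deriv (fun s ↦ e (γ s)) t)
      (deriv (fun s ↦ e (γ s)) t) = 1 → ∃ γ' : ℝ → M,
        velocity γ' 0 = ⟨e.symm (e (γ t)), chartSymmDeriv e (e (γ t)) (deriv (fun s ↦ e (γ s)) t)⟩ ∧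
        ∀ t ∈ Ioo (-ε) ε, IsGeodesicAt γ' t := by
    rw [nhds_prod_eq, eventually_prod_iff] at hgeo
    obtain ⟨p₁, hp₁, p₂, hp₂, hp⟩ := hgeo
    have h2 : ∃ᶠ t in 𝓝[<] b, p₂ (deriv (fun s ↦ e (γ s)) t) := ha₀.frequently hp₂
    exact (h2.and_eventually (hx.eventually hp₁)).mono fun t ht ↦ hp ht.2 ht.1
  -- Restarting at a time `t₁` within `ε` of `b` carries the geodesic past `b`.
  have hclose : ∀ᶠ t in 𝓝[<] b, t ∈ Ioo (b - ε) b := Ioo_mem_nhdsLT (by linarith)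
  obtain ⟨t₁, hγ₁, hu₁, ⟨hs₁, hm₁⟩, hc₁⟩ :=
    (hfreq.and_eventually (hunit.and (hev.and hclose))).exists
  obtain ⟨γ₁, hv₁, hg₁⟩ := hγ₁ hu₁
  have hg₂ : ∀ t ∈ Ioo (t₁ - ε) (t₁ + ε), IsGeodesicAt (fun s ↦ γ₁ (s + -t₁)) t := by
    intro t ht
    apply IsGeodesicAt.comp_shift
    filter_upwards [Ioo_mem_nhds (show -ε < t + -t₁ by linarith [ht.1])
      (show t + -t₁ < ε by linarith [ht.2])] with s hs
    exact hg₁ s hs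
  have hv₂ : velocity (fun s ↦ γ₁ (s + -t₁)) t₁ = velocity γ t₁ := by
    rw [velocity_comp_shift (by simpa using (hg₁ 0 ⟨by linarith, hε⟩).mdifferentiableAt)]
    rw [add_neg_cancel, hv₁]
    exact TotalSpace.ext (e.left_inv hs₁)
      (heq_of_eq (velocity_snd_eq (h t₁ hm₁).mdifferentiableAt he hs₁).symm)
  have heq : EqOn γ (fun s ↦ γ₁ (s + -t₁)) (Ioo (max a (t₁ - ε)) b) := by
    refine eqOn_of_velocity_eq isOpen_Ioo isPreconnected_Ioo (t₀ := t₁)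
      (fun t ht ↦ h t ⟨(le_max_left _ _).trans_lt ht.1, ht.2⟩)
      (fun t ht ↦ hg₂ t ⟨(le_max_right _ _).trans_lt ht.1, ?_⟩) ⟨max_lt hm₁.1 (by linarith), hm₁.2⟩
      hv₂.symm
    linarith [ht.2, hc₁.1]
  have hmax : max a (t₁ - ε) < t₁ := max_lt hm₁.1 (by linarith)
  have hlow : EqOn (fun s ↦ if s ≤ t₁ then γ s else γ₁ (s + -t₁)) γ (Ioo a b) := by
    intro s hs
    by_cases hst : s ≤ t₁
    · simp [hst]
    · simp only [hst, if_false]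
      exact (heq ⟨hmax.trans (not_le.1 hst), hs.2⟩).symm
  refine ⟨t₁ + ε, by linarith [hc₁.1], fun s ↦ if s ≤ t₁ then γ s else γ₁ (s + -t₁), hlow,
    fun r hr ↦ ?_⟩
  rcases lt_or_ge r b with hrb | hrb
  · refine (h r ⟨hr.1, hrb⟩).congr ?_
    filter_upwards [Ioo_mem_nhds hr.1 hrb] with s hs
    exact hlow hs
  · refine (hg₂ r ⟨by linarith [hm₁.2], hr.2⟩).congr ?_
    filter_upwards [lt_mem_nhds (hm₁.2.trans_le hrb)] with s hs
    simp [not_le.2 hs]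

theorem exists_extend_left {γ : ℝ → M} {a b : ℝ} (hab : a < b)
    (h : ∀ r ∈ Ioo a b, IsGeodesicAt γ r) :
    ∃ a' < a, ∃ γ' : ℝ → M, EqOn γ' γ (Ioo a b) ∧ ∀ r ∈ Ioo a' b, IsGeodesicAt γ' r := by
  have hneg : ∀ {c d : ℝ} {γ : ℝ → M}, (∀ r ∈ Ioo c d, IsGeodesicAt γ r) →
      ∀ r ∈ Ioo (-d) (-c), IsGeodesicAt (fun s ↦ γ (-s)) r := by
    intro c d γ hγ r hr
    apply IsGeodesicAt.comp_neg
    filter_upwards [Ioo_mem_nhds (show c < -r by linarith [hr.2]) (show -r < d by linarith [hr.1])]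
      with s hs
    exact hγ s hs
  obtain ⟨b', hb', γ', heq, hγ'⟩ := exists_extend_right (neg_lt_neg hab) (hneg h)
  refine ⟨-b', by linarith, fun s ↦ γ' (-s), fun s hs ↦ ?_, ?_⟩
  · simpa using heq (⟨neg_lt_neg hs.2, neg_lt_neg hs.1⟩ : -s ∈ Ioo (-b) (-a))
  · simpa using hneg hγ'

/-- **Geodesic completeness** of complete Riemannian surfaces. -/
theorem exists_isUnitSpeedGeodesic (v : UnitTangentBundle M) :
    ∃ γ : ℝ → M, IsUnitSpeedGeodesic γ ∧ velocity γ 0 = v.1 := by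
  set S : Set ℝ := {b | ∃ γ : ℝ → M, velocity γ 0 = v.1 ∧ ∀ r ∈ Ioo (-b) b, IsGeodesicAt γ r}
    with hS
  have hpos : ∃ b ∈ S, 0 < b := by
    set p := v.1.proj
    set e := chartAt Plane p with hedef
    have he : e ∈ IsManifold.maximalAtlas (𝓡 2) ∞ M := IsManifold.chart_mem_maximalAtlas _
    have hpe : p ∈ e.source := mem_chart_source _ _
    obtain ⟨ε, hε, h⟩ := exists_isGeodesicAt he (e.map_source hpe)
      (mfderiv (𝓡 2) (𝓡 2) e p v.1.2)
    obtain ⟨γ, hγ, hγ'⟩ := h.self_of_nhds (by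
      rw [metricForm_apply, chartMetric_eq_metricAt]
      simp only
      rw [chartSymmDeriv_mfderiv he hpe, e.left_inv hpe]
      exact (metricAt_self p _).trans ((congrArg (· ^ 2) v.2).trans (one_pow 2)))
    exact ⟨ε, ⟨γ, hγ.trans (TotalSpace.ext (e.left_inv hpe)
      (heq_of_eq (chartSymmDeriv_mfderiv he hpe v.1.2))), hγ'⟩, hε⟩
  obtain ⟨γ, hγ0, hγ⟩ := exists_glue (S := S) (fun b hb ↦ hb) hpos
  -- If the half-lengths of symmetric intervals of existence were bounded, extending the geodesic on
  -- their union at both ends would exceed their supremum.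
  by_cases hbdd : BddAbove S
  · obtain ⟨b₀, hb₀, hb₀'⟩ := hpos
    have hB : 0 < sSup S := hb₀'.trans_le (le_csSup hbdd hb₀)
    have hγB : ∀ r ∈ Ioo (-sSup S) (sSup S), IsGeodesicAt γ r := by
      intro r hr
      obtain ⟨b, hb, hrb⟩ := exists_lt_of_lt_csSup ⟨b₀, hb₀⟩ (abs_lt.2 hr)
      exact hγ b hb r (abs_lt.1 hrb)
    obtain ⟨b', hb', γ', heq', hγ'⟩ := exists_extend_right (by linarith) hγB
    obtain ⟨a', ha', γ'', heq'', hγ''⟩ := exists_extend_left (by linarith) hγ'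
    have hmem : min (-a') b' ∈ S := by
      refine ⟨γ'', ?_, fun r hr ↦ hγ'' r ⟨?_, hr.2.trans_le (min_le_right _ _)⟩⟩
      · have h1 : γ'' =ᶠ[𝓝 0] γ' := by
          filter_upwards [Ioo_mem_nhds (neg_neg_of_pos hB) (hB.trans hb')] with s hs using heq'' hs
        have h2 : γ' =ᶠ[𝓝 0] γ := by
          filter_upwards [Ioo_mem_nhds (neg_neg_of_pos hB) hB] with s hs using heq' hs
        rw [velocity_congr h1, velocity_congr h2, hγ0]
      · have := (neg_le_neg (min_le_left (-a') b')).trans_lt hr.1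
        linarith
    have := le_csSup hbdd hmem
    exact absurd this (not_le.2 (lt_min (by linarith) hb'))
  · refine ⟨γ, isUnitSpeedGeodesic_iff.2 fun t ↦ ?_, hγ0⟩
    obtain ⟨b, hb, htb⟩ := not_bddAbove_iff.1 hbdd |t|
    exact hγ b hb t (abs_lt.1 htb)

end Completeness

/-! ### Flat charts, height and slope on the cylinder -/

section FlatCylinder

set_option maxSynthPendingDepth 3

theorem isOpen_openStrip (l : ℝ) : IsOpen (openStrip l) := by
  have : Continuous fun p : Plane ↦ p 0 := by fun_prop
  exact isOpen_Ioo.preimage this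

theorem openStrip_subset_closedStrip (l : ℝ) : openStrip l ⊆ closedStrip l :=
  fun _ hp ↦ Ioo_subset_Icc_self hp

theorem closedStrip_mem_nhds {l : ℝ} {p : Plane} (hp : p ∈ openStrip l) : closedStrip l ∈ 𝓝 p :=
  mem_of_superset ((isOpen_openStrip l).mem_nhds hp) (openStrip_subset_closedStrip l)

variable {M : Type*} [TopologicalSpace M] [ChartedSpace Plane M]
  [RiemannianBundle (fun x : M ↦ TangentSpace (𝓡 2) x)]

namespace EmbeddedFlatCylinder

variable (C : EmbeddedFlatCylinder M)

theorem contMDiffOn_openStrip : ContMDiffOn (𝓡 2) (𝓡 2) ∞ C.toFun (openStrip C.l) :=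
  C.smooth.mono (openStrip_subset_closedStrip _)

/-- The derivative of the parametrization of the cylinder, as a map of the model spaces. -/
def deriv (p : Plane) : Plane →L[ℝ] Plane := mfderiv (𝓡 2) (𝓡 2) C.toFun p

variable {C}

theorem contMDiffAt_toFun {p : Plane} (hp : p ∈ openStrip C.l) :
    ContMDiffAt (𝓡 2) (𝓡 2) ∞ C.toFun p :=
  C.contMDiffOn_openStrip.contMDiffAt ((isOpen_openStrip _).mem_nhds hp)

theorem mdifferentiableAt_toFun {p : Plane} (hp : p ∈ openStrip C.l) :
    MDifferentiableAt (𝓡 2) (𝓡 2) C.toFun p :=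
  (contMDiffAt_toFun hp).mdifferentiableAt (by simp)

theorem metricAt_deriv_self {p : Plane} (hp : p ∈ openStrip C.l) (a : Plane) :
    metricAt (C.toFun p) (C.deriv p a) (C.deriv p a) = ‖a‖ ^ 2 := by
  have h := C.isometric p (openStrip_subset_closedStrip _ hp) a
  rw [mfderivWithin_of_mem_nhds (closedStrip_mem_nhds hp)] at h
  rw [metricAt_self, ← h]
  rfl

/-- Polarization of the preservation of norms. -/
theorem metricAt_deriv {p : Plane} (hp : p ∈ openStrip C.l) (a b : Plane) :
    metricAt (C.toFun p) (C.deriv p a) (C.deriv p b) = inner ℝ a b := by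
  have h1 := metricAt_deriv_self hp (a + b)
  have h2 := metricAt_deriv_self hp a
  have h3 := metricAt_deriv_self hp b
  simp only [← metricFormAt_apply, map_add, _root_.add_apply] at h1 h2 h3 ⊢
  have h4 : metricFormAt (C.toFun p) (C.deriv p b) (C.deriv p a) =
      metricFormAt (C.toFun p) (C.deriv p a) (C.deriv p b) := metricAt_comm _ _ _
  rw [norm_add_sq_real] at h1
  linarith

theorem deriv_injective {p : Plane} (hp : p ∈ openStrip C.l) :
    Function.Injective (C.deriv p) := by
  rw [injective_iff_map_eq_zero]
  intro a ha
  have := metricAt_deriv_self hp a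
  rw [ha, ← metricFormAt_apply, map_zero] at this
  have h0 : ‖a‖ ^ 2 = 0 := this.symm
  simpa using h0

theorem deriv_surjective {p : Plane} (hp : p ∈ openStrip C.l) :
    Function.Surjective (C.deriv p) :=
  LinearMap.injective_iff_surjective (f := (C.deriv p : Plane →ₗ[ℝ] Plane)).1 (deriv_injective hp)

/-- The parametrization of the cylinder is locally the inverse of a chart of the surface. -/
theorem exists_chart [IsManifold (𝓡 2) ∞ M] {p : Plane} (hp : p ∈ openStrip C.l) :
    ∃ e ∈ IsManifold.maximalAtlas (𝓡 2) ∞ M, C.toFun p ∈ e.source ∧ e.target ⊆ openStrip C.l ∧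
      ∀ x ∈ e.target, e.symm x = C.toFun x := by
  set φ := chartAt Plane (C.toFun p) with hφ
  have hφm : φ ∈ IsManifold.maximalAtlas (𝓡 2) ∞ M := IsManifold.chart_mem_maximalAtlas _
  set W : Set Plane := openStrip C.l ∩ C.toFun ⁻¹' φ.source with hW
  have hWo : IsOpen W := C.contMDiffOn_openStrip.continuousOn.isOpen_inter_preimage
    (isOpen_openStrip _) φ.open_source
  have hpW : p ∈ W := ⟨hp, mem_chart_source _ _⟩
  set g : Plane → Plane := φ ∘ C.toFun with hg
  have hgs : ∀ x ∈ W, ContDiffAt ℝ ∞ g x := fun x hx ↦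
    ((contMDiffAt_of_mem_maximalAtlas hφm hx.2).comp x (contMDiffAt_toFun hx.1)).contDiffAt
  have hgd : ∀ x ∈ W, ∃ L : Plane ≃L[ℝ] Plane, HasFDerivAt g (L : Plane →L[ℝ] Plane) x := by
    intro x hx
    have h1 : fderiv ℝ g x =
        (mfderiv (𝓡 2) (𝓡 2) φ (C.toFun x) : Plane →L[ℝ] Plane).comp (C.deriv x) := by
      have := mfderiv_comp x (mdifferentiableAt_chart hφm hx.2) (mdifferentiableAt_toFun hx.1)
      rwa [mfderiv_eq_fderiv] at this
    have hinj : Function.Injective (fderiv ℝ g x) := by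
      intro a b hab
      rw [h1] at hab
      have h2 := congrArg (chartSymmDeriv φ (φ (C.toFun x))) hab
      exact deriv_injective hx.1 ((chartSymmDeriv_mfderiv hφm hx.2 (C.deriv x a)).symm.trans
        (h2.trans (chartSymmDeriv_mfderiv hφm hx.2 (C.deriv x b))))
    refine ⟨(LinearEquiv.ofInjectiveEndo (fderiv ℝ g x : Plane →ₗ[ℝ] Plane)
      hinj).toContinuousLinearEquiv, ?_⟩
    have h2 : ((LinearEquiv.ofInjectiveEndo (fderiv ℝ g x : Plane →ₗ[ℝ] Plane)
        hinj).toContinuousLinearEquiv : Plane →L[ℝ] Plane) = fderiv ℝ g x := rfl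
    rw [h2]
    exact ((hgs x hx).differentiableAt (by simp)).hasFDerivAt
  obtain ⟨L, hL⟩ := hgd p hpW
  set h := (hgs p hpW).toOpenPartialHomeomorph g hL (by simp) with hh
  have hcoe : ∀ x, h x = g x := fun x ↦ rfl
  -- The inverse function theorem gives `h` from the derivative at `p` alone. On `W` the derivative
  -- is invertible everywhere, so after restriction the inverse is smooth on its whole domain.
  set E : OpenPartialHomeomorph Plane M := (h.restrOpen W hWo).trans φ.symm with hE
  have hEs : ∀ x ∈ E.source, x ∈ h.source ∧ x ∈ W := by
    intro x hx
    rw [hE, OpenPartialHomeomorph.trans_source] at hx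
    simpa using hx.1
  have hEF : ∀ x ∈ E.source, E x = C.toFun x := by
    intro x hx
    have h1 : E x = φ.symm (g x) := rfl
    rw [h1]
    exact φ.left_inv (hEs x hx).2.2
  refine ⟨E.symm, ?_, ?_, fun x hx ↦ (hEs x hx).2.1, hEF⟩
  · refine OpenPartialHomeomorph.mem_maximalAtlas_of_contMDiffOn _ ?_ ?_
    · intro y hy
      have hyE : E.symm y ∈ E.source := E.map_target hy
      have h1 := hEs _ hyE
      have hyF : C.toFun (E.symm y) = y := by rw [← hEF _ hyE]; exact E.right_inv hy
      have hyφ : y ∈ φ.source := hyF ▸ h1.2.2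
      have hgy : h (E.symm y) = φ y := by rw [hcoe, hg]; simp only [Function.comp, hyF]
      have hty : φ y ∈ h.target := hgy ▸ h.map_source h1.1
      have hsy : h.symm (φ y) = E.symm y := rfl
      obtain ⟨L', hL'⟩ := hgd _ h1.2
      have h2 : ContDiffAt ℝ ∞ h.symm (φ y) :=
        h.contDiffAt_symm hty (by rw [hsy]; exact hL') (by rw [hsy]; exact hgs _ h1.2)
      exact (h2.contMDiffAt.comp y (contMDiffAt_of_mem_maximalAtlas hφm hyφ)).contMDiffWithinAt
    · refine (C.contMDiffOn_openStrip.mono fun x hx ↦ (hEs x hx).2.1).congr hEF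
  · have hpE : p ∈ E.source := by
      rw [hE, OpenPartialHomeomorph.trans_source]
      refine ⟨?_, ?_⟩
      · simpa using ⟨(hgs p hpW).mem_toOpenPartialHomeomorph_source hL (by simp), hpW⟩
      · exact φ.map_source hpW.2
    rw [← hEF p hpE]
    exact E.map_source hpE

theorem chartSymmDeriv_eq {e : OpenPartialHomeomorph M Plane}
    (heF : ∀ x ∈ e.target, e.symm x = C.toFun x) {x : Plane} (hx : x ∈ e.target) :
    chartSymmDeriv e x = C.deriv x := by
  have : e.symm =ᶠ[𝓝 x] C.toFun := by
    filter_upwards [e.open_target.mem_nhds hx] with y hy using heF y hy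
  exact this.mfderiv_eq

theorem metricForm_eq_inner {e : OpenPartialHomeomorph M Plane} (heS : e.target ⊆ openStrip C.l)
    (heF : ∀ x ∈ e.target, e.symm x = C.toFun x) {x : Plane} (hx : x ∈ e.target) :
    metricForm e x = innerSL ℝ := by
  ext a b
  rw [metricForm_apply, chartMetric_eq_metricAt, chartSymmDeriv_eq heF hx, heF x hx,
    metricAt_deriv (heS hx)]
  rfl

theorem lagrangeForce_eq_zero {e : OpenPartialHomeomorph M Plane} (heS : e.target ⊆ openStrip C.l)
    (heF : ∀ x ∈ e.target, e.symm x = C.toFun x) {x : Plane} (hx : x ∈ e.target) (a : Plane) :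
    lagrangeForce (metricForm e) x a = 0 := by
  have h1 : metricForm e =ᶠ[𝓝 x] fun _ ↦ innerSL ℝ := by
    filter_upwards [e.open_target.mem_nhds hx] with y hy using metricForm_eq_inner heS heF hy
  have h2 : fderiv ℝ (metricForm e) x = 0 := by
    rw [h1.fderiv_eq]
    exact fderiv_const_apply _
  ext ξ
  rw [lagrangeForce_apply, h2]
  simp

variable (C) in
open Classical in
/-- The coordinate across the cylinder, extended by `0` outside of the interior. -/
def height (m : M) : ℝ := if h : m ∈ C.interior then h.choose 0 else 0

theorem toFun_mem_interior {p : Plane} (hp : p ∈ openStrip C.l) : C.toFun p ∈ C.interior :=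
  mem_image_of_mem _ hp

theorem height_toFun {p : Plane} (hp : p ∈ openStrip C.l) : C.height (C.toFun p) = p 0 := by
  have h : C.toFun p ∈ C.interior := toFun_mem_interior hp
  rw [height, dif_pos h]
  exact ((C.eq_iff _ (openStrip_subset_closedStrip _ h.choose_spec.1) _
    (openStrip_subset_closedStrip _ hp)).1 h.choose_spec.2).1

theorem height_of_notMem {m : M} (hm : m ∉ C.interior) : C.height m = 0 := dif_neg hm

theorem height_mem_Ioo {m : M} (hm : m ∈ C.interior) : C.height m ∈ Ioo 0 C.l := by
  obtain ⟨p, hp, rfl⟩ := hm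
  rw [height_toFun hp]
  exact hp

/-- The default value `0` of the height lies outside `(0, l)`, so the height alone detects the
interior. This lets the later argument speak of real functions only. -/
theorem mem_interior_iff {m : M} : m ∈ C.interior ↔ 0 < C.height m := by
  refine ⟨fun h ↦ (height_mem_Ioo h).1, fun h ↦ ?_⟩
  by_contra hm
  rw [height_of_notMem hm] at h
  exact lt_irrefl _ h

/-- Flat charts on the interior of the cylinder. -/
theorem exists_flat_chart [IsManifold (𝓡 2) ∞ M] {m : M} (hm : m ∈ C.interior) :
    ∃ e ∈ IsManifold.maximalAtlas (𝓡 2) ∞ M, m ∈ e.source ∧ e.target ⊆ openStrip C.l ∧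
      (∀ x ∈ e.target, e.symm x = C.toFun x) ∧ e.source ⊆ C.interior ∧
      ∀ y ∈ e.source, C.height y = e y 0 := by
  obtain ⟨p, hp, rfl⟩ := hm
  obtain ⟨e, he, hpe, heS, heF⟩ := exists_chart hp
  have hy : ∀ y ∈ e.source, C.toFun (e y) = y := fun y hy ↦ by
    rw [← heF _ (e.map_source hy), e.left_inv hy]
  refine ⟨e, he, hpe, heS, heF, fun y hys ↦ ⟨e y, heS (e.map_source hys), hy y hys⟩,
    fun y hys ↦ ?_⟩
  conv_lhs => rw [← hy y hys]
  exact height_toFun (heS (e.map_source hys))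

section

variable [IsManifold (𝓡 2) ∞ M]

theorem isOpen_interior : IsOpen C.interior := by
  rw [isOpen_iff_mem_nhds]
  intro m hm
  obtain ⟨e, -, hme, -, -, hs, -⟩ := exists_flat_chart hm
  exact mem_of_superset (e.open_source.mem_nhds hme) hs

theorem contMDiffOn_height : ContMDiffOn (𝓡 2) 𝓘(ℝ, ℝ) ∞ C.height C.interior := by
  intro m hm
  obtain ⟨e, he, hme, -, -, -, hX⟩ := exists_flat_chart hm
  have h1 : ContMDiffAt (𝓡 2) 𝓘(ℝ, ℝ) ∞ (fun y ↦ e y 0) m := by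
    have h2 : ContDiff ℝ ∞ fun p : Plane ↦ p 0 := by fun_prop
    exact h2.contMDiff.contMDiffAt.comp m (contMDiffAt_of_mem_maximalAtlas he hme)
  refine (h1.congr_of_eventuallyEq ?_).contMDiffWithinAt
  filter_upwards [e.open_source.mem_nhds hme] with y hy using hX y hy

theorem contMDiffAt_height {m : M} (hm : m ∈ C.interior) :
    ContMDiffAt (𝓡 2) 𝓘(ℝ, ℝ) ∞ C.height m :=
  contMDiffOn_height.contMDiffAt (isOpen_interior.mem_nhds hm)

theorem mdifferentiableAt_height {m : M} (hm : m ∈ C.interior) :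
    MDifferentiableAt (𝓡 2) 𝓘(ℝ, ℝ) C.height m :=
  (contMDiffAt_height hm).mdifferentiableAt (by simp)

theorem continuousAt_height {m : M} (hm : m ∈ C.interior) : ContinuousAt C.height m :=
  (contMDiffAt_height hm).continuousAt

end

variable (C) in
/-- The component across the cylinder of a tangent vector. -/
def slope (u : TangentBundle (𝓡 2) M) : ℝ :=
  (mfderiv (𝓡 2) 𝓘(ℝ, ℝ) C.height u.1 : Plane →L[ℝ] ℝ) u.2

theorem exists_eq_toFun {u : TangentBundle (𝓡 2) M} (hu : u.1 ∈ C.interior) :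
    ∃ p ∈ openStrip C.l, ∃ a : Plane, u = ⟨C.toFun p, C.deriv p a⟩ ∧ ‖u.2‖ = ‖a‖ := by
  obtain ⟨p, hp, hpu⟩ := hu
  obtain ⟨m, w⟩ := u
  obtain rfl : C.toFun p = m := hpu
  obtain ⟨a, rfl⟩ := deriv_surjective hp w
  refine ⟨p, hp, a, rfl, ?_⟩
  have h1 := metricAt_deriv_self hp a
  rw [metricAt_self] at h1
  exact (sq_eq_sq₀ (norm_nonneg _) (norm_nonneg _)).1 h1

variable [IsManifold (𝓡 2) ∞ M]

theorem slope_toFun {p : Plane} (hp : p ∈ openStrip C.l) (a : Plane) :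
    C.slope ⟨C.toFun p, C.deriv p a⟩ = a 0 := by
  have h1 : C.height ∘ C.toFun =ᶠ[𝓝 p] fun q ↦ q 0 := by
    filter_upwards [(isOpen_openStrip _).mem_nhds hp] with q hq using height_toFun hq
  have h2 := mfderiv_comp p (mdifferentiableAt_height (toFun_mem_interior hp))
    (mdifferentiableAt_toFun hp)
  rw [h1.mfderiv_eq, mfderiv_eq_fderiv] at h2
  have h3 : HasFDerivAt (fun q : Plane ↦ q 0) (EuclideanSpace.proj 0 : Plane →L[ℝ] ℝ) p :=
    (EuclideanSpace.proj 0 : Plane →L[ℝ] ℝ).hasFDerivAt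
  rw [h3.fderiv] at h2
  exact (congrArg (fun L : Plane →L[ℝ] ℝ ↦ L a) h2).symm

theorem abs_slope_le {u : TangentBundle (𝓡 2) M} (hu : u.1 ∈ C.interior) :
    |C.slope u| ≤ ‖u.2‖ := by
  obtain ⟨p, hp, a, rfl, ha⟩ := exists_eq_toFun hu
  rw [slope_toFun hp, ha]
  exact PiLp.norm_apply_le a 0

theorem continuousOn_slope :
    ContinuousOn C.slope {u : TangentBundle (𝓡 2) M | u.1 ∈ C.interior} := by
  have h1 := (contMDiffOn_height (C := C)).continuousOn_tangentMapWithin (by simp)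
    isOpen_interior.uniqueMDiffOn
  have h2 : Continuous fun u : TangentBundle 𝓘(ℝ, ℝ) ℝ ↦ u.2 := by
    exact (tangentBundleModelSpaceHomeomorph 𝓘(ℝ, ℝ)).continuous.snd
  refine (h2.comp_continuousOn h1).congr fun u hu ↦ ?_
  simp only [Function.comp, tangentMapWithin,
    mfderivWithin_of_mem_nhds (isOpen_interior.mem_nhds hu)]
  rfl

theorem continuousAt_slope {u : TangentBundle (𝓡 2) M} (hu : u.1 ∈ C.interior) :
    ContinuousAt C.slope u := by
  refine continuousOn_slope.continuousAt (IsOpen.mem_nhds ?_ hu)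
  exact isOpen_interior.preimage (FiberBundle.continuous_proj Plane (TangentSpace (𝓡 2)))

theorem hasDerivAt_height {γ : ℝ → M} {t : ℝ}
    (hγ : MDifferentiableAt 𝓘(ℝ, ℝ) (𝓡 2) γ t) (ht : γ t ∈ C.interior) :
    HasDerivAt (fun s ↦ C.height (γ s)) (C.slope (velocity γ t)) t := by
  have hd : DifferentiableAt ℝ (fun s ↦ C.height (γ s)) t :=
    ((mdifferentiableAt_height ht).comp t hγ).differentiableAt
  have h := mfderiv_comp t (mdifferentiableAt_height ht) hγ
  rw [mfderiv_eq_fderiv] at h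
  have h2 : C.slope (velocity γ t) = _root_.deriv (fun s ↦ C.height (γ s)) t :=
    (congrArg (fun L : ℝ →L[ℝ] ℝ ↦ L 1) h).symm
  rw [h2]
  exact hd.hasDerivAt

/-- Geodesics are straight lines inside the cylinder. -/
theorem hasDerivAt_slope {γ : ℝ → M} {t : ℝ} (hγ : ∀ᶠ s in 𝓝 t, IsGeodesicAt γ s)
    (ht : γ t ∈ C.interior) : HasDerivAt (fun s ↦ C.slope (velocity γ s)) 0 t := by
  obtain ⟨e, he, hme, heS, heF, hes, hX⟩ := exists_flat_chart ht
  have hev : ∀ᶠ s in 𝓝 t, γ s ∈ e.source :=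
    hγ.self_of_nhds.smooth.continuousAt.eventually_mem (e.open_source.mem_nhds hme)
  have h1 := hγ.self_of_nhds.coord e he hme
  unfold IsCoordGeodesicAt at h1
  rw [lagrangeForce_eq_zero heS heF (e.map_source hme)] at h1
  -- In a flat chart the force vanishes, so the momentum has derivative zero. Its pairing with the
  -- vector across the cylinder is the slope.
  have h2 := HasDerivAt.clm_apply h1 (hasDerivAt_const t (EuclideanSpace.single (0 : Fin 2) (1 : ℝ)))
  simp only [map_zero, add_zero, _root_.zero_apply] at h2
  refine h2.congr_of_eventuallyEq ?_
  filter_upwards [hev.eventually_nhds, hγ] with s hs hsγ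
  have hss := hs.self_of_nhds
  rw [metricForm_eq_inner heS heF (e.map_source hss)]
  have h3 : HasDerivAt (fun r ↦ e (γ r) 0) (C.slope (velocity γ s)) s := by
    refine (hasDerivAt_height hsγ.mdifferentiableAt (hes hss)).congr_of_eventuallyEq ?_
    filter_upwards [hs] with r hr using (hX _ hr).symm
  have h4 : HasDerivAt (fun r ↦ e (γ r) 0) (_root_.deriv (fun r ↦ e (γ r)) s 0) s :=
    (EuclideanSpace.proj 0 : Plane →L[ℝ] ℝ).hasFDerivAt.comp_hasDerivAt s
      (differentiableAt_chart_comp hsγ.mdifferentiableAt he hss).hasDerivAt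
  rw [h3.unique h4]
  rw [innerSL_apply_apply]
  simp [PiLp.inner_apply]

end EmbeddedFlatCylinder

end FlatCylinder

/-! ### Shadowing for functions that are affine inside an interval -/

section Straight

/-- The function `f`, of derivative `g`, is affine as long as it takes its values in `(0, l)`. -/
def IsStraightIn (l : ℝ) (f g : ℝ → ℝ) : Prop :=
  ∀ t₁, f t₁ ∈ Ioo 0 l → ∀ t, f t₁ + g t₁ * (t - t₁) ∈ Ioo 0 l →
    f t = f t₁ + g t₁ * (t - t₁) ∧ g t = g t₁

namespace IsStraightIn

variable {l : ℝ} {f g f₀ g₀ : ℝ → ℝ}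

/-- Time reversal lets what is proved about the departure at time `0` be applied to the return at
time `T`. -/
theorem reverse (h : IsStraightIn l f g) (T : ℝ) :
    IsStraightIn l (fun t ↦ f (T - t)) (fun t ↦ -g (T - t)) := by
  intro t₁ h₁ t ht
  have e : f (T - t₁) + -g (T - t₁) * (t - t₁) =
      f (T - t₁) + g (T - t₁) * ((T - t) - (T - t₁)) := by ring
  simp only [e] at ht ⊢
  obtain ⟨h2, h3⟩ := h _ h₁ _ ht
  exact ⟨h2, by rw [h3]⟩

/-- Exchanging the two sides of the interval reduces a downward start to an upward one. -/
theorem reflect (h : IsStraightIn l f g) : IsStraightIn l (fun t ↦ l - f t) (fun t ↦ -g t) := by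
  intro t₁ h₁ t ht
  obtain ⟨h2, h3⟩ := h t₁ ⟨by linarith [h₁.2], by linarith [h₁.1]⟩ t
    ⟨by linarith [ht.2], by linarith [ht.1]⟩
  exact ⟨by simp only [h2]; ring, by simp only [h3]⟩

theorem eq_of_mem_Icc (hf : IsStraightIn l f g) {b : ℝ} (h0 : 0 < f 0) (hb : f 0 < b) (hbl : b < l)
    (hg0 : 0 < g 0) {t : ℝ} (ht : t ∈ Icc 0 ((b - f 0) / g 0)) :
    f t = f 0 + g 0 * t ∧ g t = g 0 ∧ f t ∈ Icc (f 0) b := by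
  have h1 : g 0 * t ≤ b - f 0 := by
    have := (le_div_iff₀ hg0).1 ht.2
    linarith
  have h2 : 0 ≤ g 0 * t := mul_nonneg hg0.le ht.1
  have h3 := hf 0 ⟨h0, hb.trans hbl⟩ t
  rw [sub_zero] at h3
  obtain ⟨h4, h5⟩ := h3 ⟨by linarith, by linarith⟩
  exact ⟨h4, h5, by rw [h4]; constructor <;> linarith⟩

/-- A function that starts upwards and comes back has to leave `(0, l)` in between. -/
theorem div_le_of_turn (hf : IsStraightIn l f g) {b T : ℝ} (h0 : 0 < f 0) (hb : f 0 < b)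
    (hbl : b < l) (hg0 : 0 < g 0) (hT : 0 ≤ T) (hgT : g T < 0) : (b - f 0) / g 0 ≤ T := by
  by_contra! h
  have := (hf.eq_of_mem_Icc h0 hb hbl hg0 ⟨hT, h.le⟩).2.1
  linarith

/-- A function that shadows one that starts upwards and comes back has to start upwards. -/
theorem slope_pos_of_shadow (hf : IsStraightIn l f g) (hf₀ : IsStraightIn l f₀ g₀)
    {a b x η T : ℝ} (ha : 0 < a) (hax : a + 3 * η ≤ x) (hxb : x + 3 * η ≤ b) (hbl : b < l)
    (hx : |f 0 - x| < η) (hT : 0 ≤ T) (hg0 : 0 < g 0) (hgT : g T < 0)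
    (hsh : ∀ t ∈ Icc 0 T, f t ∈ Icc a b → |f₀ t - f t| < η) : 0 < g₀ 0 := by
  have hx' := abs_lt.1 hx
  have hη : 0 < η := (abs_nonneg _).trans_lt hx
  have h0 : 0 < f 0 := by linarith
  have hb : f 0 < b := by linarith
  set τ := (b - f 0) / g 0 with hτ
  have hτ0 : 0 < τ := div_pos (by linarith) hg0
  have hτT : τ ≤ T := hf.div_le_of_turn h0 hb hbl hg0 hT hgT
  have hsh' : ∀ t ∈ Icc 0 τ, |f₀ t - f t| < η ∧ f 0 ≤ f t := by
    intro t ht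
    have h1 := (hf.eq_of_mem_Icc h0 hb hbl hg0 ht).2.2
    exact ⟨hsh t ⟨ht.1, ht.2.trans hτT⟩ ⟨by linarith [h1.1], h1.2⟩, h1.1⟩
  have hs0 := abs_lt.1 (hsh' 0 ⟨le_rfl, hτ0.le⟩).1
  have hsτ := abs_lt.1 (hsh' τ ⟨hτ0.le, le_rfl⟩).1
  have hfτ : f τ = b := by
    rw [(hf.eq_of_mem_Icc h0 hb hbl hg0 ⟨hτ0.le, le_rfl⟩).1, hτ, mul_div_cancel₀ _ hg0.ne']
    ring
  have hmem : f₀ 0 ∈ Ioo 0 l := ⟨by linarith, by linarith⟩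
  by_contra! hneg
  -- If the line of `f₀` stays positive up to time `τ`, then `f₀ τ ≤ f₀ 0 < x + 2η`, too low to
  -- shadow `f τ = b`.
  rcases lt_or_ge 0 (f₀ 0 + g₀ 0 * (τ - 0)) with hpos | hnon
  · have h2 : g₀ 0 * (τ - 0) ≤ 0 := mul_nonpos_of_nonpos_of_nonneg hneg (by linarith)
    have h3 := (hf₀ 0 hmem τ ⟨hpos, by linarith [hmem.2]⟩).1
    linarith
  · have hlt : g₀ 0 < 0 := by
      refine lt_of_le_of_ne hneg fun h ↦ ?_
      rw [h] at hnon
      linarith [hmem.1]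
    -- Otherwise the line of `f₀` descends to `0` before `τ`, and so meets the level `a / 2` at this
    -- time, still inside `(0, l)`. But `f` has stayed above `f 0 > a + 2η`.
    set t := (a / 2 - f₀ 0) / g₀ 0 with ht
    have ht1 : g₀ 0 * t = a / 2 - f₀ 0 := mul_div_cancel₀ _ hlt.ne
    have ht0 : 0 ≤ t := div_nonneg_of_nonpos (by linarith) hlt.le
    have htτ : t ≤ τ := by
      by_contra! h
      nlinarith
    have h3 := (hf₀ 0 hmem t (by rw [sub_zero, ht1]; constructor <;> linarith)).1
    rw [sub_zero, ht1] at h3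
    have h4 := hsh' t ⟨ht0, htτ⟩
    have h5 := abs_lt.1 h4.1
    linarith [h4.2]

/-- The shadow starts upwards and, by time reversal, is going down at time `T`. Between `T` and `l'`
its line moves by less than `η`, hence stays in `(0, l)`, and `g₀ l' = g₀ T < 0 < g₀ 0`. -/
theorem not_shadow_of_turn (hf : IsStraightIn l f g) (hf₀ : IsStraightIn l f₀ g₀)
    {a b x η T l' : ℝ} (ha : 0 < a) (hax : a + 3 * η ≤ x) (hxb : x + 3 * η ≤ b) (hbl : b < l)
    (hx0 : |f 0 - x| < η) (hxT : |f T - x| < η) (hT : 0 ≤ T) (hg0 : 0 < g 0) (hgT : g T < 0)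
    (hspeed : f₀ T ∈ Ioo 0 l → |g₀ T| ≤ 1) (hper : g₀ l' = g₀ 0) (hTl : |T - l'| < η) :
    ¬ ∀ t ∈ Icc 0 T, f t ∈ Icc a b → |f₀ t - f t| < η := by
  intro hsh
  have h1 := hf.slope_pos_of_shadow hf₀ ha hax hxb hbl hx0 hT hg0 hgT hsh
  have h2 := (hf.reverse T).slope_pos_of_shadow (hf₀.reverse T) ha hax hxb hbl (by simpa using hxT)
    hT (by simpa using hgT) (by simpa using hg0)
    (fun t ht ↦ hsh (T - t) ⟨by linarith [ht.2], by linarith [ht.1]⟩)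
  simp only [sub_zero, Left.neg_pos_iff] at h2
  have hxT' := abs_lt.1 hxT
  have h3 := abs_lt.1 (hsh T ⟨hT, le_rfl⟩ ⟨by linarith, by linarith⟩)
  have hmem : f₀ T ∈ Ioo 0 l := ⟨by linarith, by linarith⟩
  have h4 : |g₀ T * (l' - T)| < η := by
    rw [abs_mul, abs_sub_comm l' T]
    calc |g₀ T| * |T - l'| ≤ 1 * |T - l'| := by gcongr; exact hspeed hmem
      _ < η := by rwa [one_mul]
  have h5 := abs_lt.1 h4
  have h6 := (hf₀ T hmem l' ⟨by linarith, by linarith⟩).2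
  linarith

theorem not_shadow (hf : IsStraightIn l f g) (hf₀ : IsStraightIn l f₀ g₀)
    {a b x η T l' : ℝ} (ha : 0 < a) (hax : a + 3 * η ≤ x) (hxb : x + 3 * η ≤ b) (hbl : b < l)
    (hx0 : |f 0 - x| < η) (hxT : |f T - x| < η) (hT : 0 ≤ T) (hg : g 0 * g T < 0)
    (hspeed : f₀ T ∈ Ioo 0 l → |g₀ T| ≤ 1) (hper : g₀ l' = g₀ 0) (hTl : |T - l'| < η) :
    ¬ ∀ t ∈ Icc 0 T, f t ∈ Icc a b → |f₀ t - f t| < η := by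
  rcases mul_neg_iff.1 hg with ⟨h0, h1⟩ | ⟨h0, h1⟩
  · exact hf.not_shadow_of_turn hf₀ ha hax hxb hbl hx0 hxT hT h0 h1 hspeed hper hTl
  · intro hsh
    refine hf.reflect.not_shadow_of_turn hf₀.reflect (a := l - b) (b := l - a) (x := l - x)
      (η := η) (T := T) (l' := l') (by linarith) (by linarith) (by linarith) (by linarith) ?_ ?_ hT
      (by linarith) (by linarith) ?_ (by rw [hper]) hTl ?_
    · rw [sub_sub_sub_cancel_left, abs_sub_comm]
      exact hx0
    · rw [sub_sub_sub_cancel_left, abs_sub_comm]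
      exact hxT
    · intro h
      rw [abs_neg]
      exact hspeed ⟨by linarith [h.2], by linarith [h.1]⟩
    · intro t ht hft
      rw [sub_sub_sub_cancel_left, abs_sub_comm]
      exact hsh t ht ⟨by linarith [hft.2], by linarith [hft.1]⟩

/-- Before turning, `f` has to cover at least the distance `2η` to the level `a` or `b` at the
constant rate `|g 0|`. A small initial slope thus forces a long time. -/
theorem div_le_of_turn' (hf : IsStraightIn l f g) {a b x η T : ℝ} (ha : 0 < a)
    (hax : a + 3 * η ≤ x) (hxb : x + 3 * η ≤ b) (hbl : b < l) (hx0 : |f 0 - x| < η) (hT : 0 ≤ T)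
    (hg : g 0 * g T < 0) : 2 * η / |g 0| ≤ T := by
  have hx0' := abs_lt.1 hx0
  rcases mul_neg_iff.1 hg with ⟨h0, h1⟩ | ⟨h0, h1⟩
  · refine le_trans ?_ (hf.div_le_of_turn (b := b) (by linarith) (by linarith) hbl h0 hT h1)
    rw [abs_of_pos h0]
    gcongr
    linarith
  · refine le_trans ?_ (hf.reflect.div_le_of_turn (b := l - a) (by linarith) (by linarith)
      (by linarith) (by linarith) hT (by linarith))
    rw [abs_of_neg h0]
    have : 0 < -g 0 := by linarith
    gcongr
    linarith

end IsStraightIn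

end Straight

/-! ### Compact bands and straightness of geodesics in the cylinder -/

section Band

set_option maxSynthPendingDepth 3

variable {M : Type*} [TopologicalSpace M] [ChartedSpace Plane M]
  [RiemannianBundle (fun x : M ↦ TangentSpace (𝓡 2) x)]

namespace EmbeddedFlatCylinder

variable (C : EmbeddedFlatCylinder M)

/-- The points of the interior of the cylinder with height in `[a, b]`. -/
def band (a b : ℝ) : Set M := {m | m ∈ C.interior ∧ C.height m ∈ Icc a b}

theorem continuousOn_pushforward [IsManifold (𝓡 2) ∞ M] :
    ContinuousOn (fun q : Plane × Plane ↦
      (⟨C.toFun q.1, C.deriv q.1 q.2⟩ : TangentBundle (𝓡 2) M)) {q | q.1 ∈ openStrip C.l} := by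
  have h1 := C.contMDiffOn_openStrip.continuousOn_tangentMapWithin (by simp)
    (isOpen_openStrip C.l).uniqueMDiffOn
  have h2 : Continuous fun q : Plane × Plane ↦ (⟨q.1, q.2⟩ : TangentBundle (𝓡 2) Plane) :=
    (tangentBundleModelSpaceHomeomorph (𝓡 2)).symm.continuous
  refine (h1.comp h2.continuousOn fun q hq ↦ hq).congr fun q hq ↦ ?_
  simp only [Function.comp, tangentMapWithin,
    mfderivWithin_of_mem_nhds ((isOpen_openStrip _).mem_nhds hq)]
  rfl

variable {C}

/-- A compact fundamental domain of a closed band of the cylinder. -/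
theorem exists_isCompact_fundamentalDomain {a b : ℝ} (ha : 0 < a) (hb : b < C.l) :
    ∃ R : Set Plane, IsCompact R ∧ R ⊆ openStrip C.l ∧ (∀ p ∈ R, p 0 ∈ Icc a b) ∧
      ∀ m ∈ C.band a b, ∃ p ∈ R, C.toFun p = m := by
  set c := 2 * Real.pi * C.h with hc
  have hc0 : 0 < c := by have := C.h_pos; positivity
  refine ⟨(fun q : ℝ × ℝ ↦ (!₂[q.1, q.2] : Plane)) '' (Icc a b ×ˢ Icc 0 c), ?_, ?_, ?_, ?_⟩
  · refine (isCompact_Icc.prod isCompact_Icc).image ?_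
    fun_prop
  · rintro _ ⟨q, hq, rfl⟩
    exact ⟨ha.trans_le hq.1.1, hq.1.2.trans_lt hb⟩
  · rintro _ ⟨q, hq, rfl⟩
    exact hq.1
  · rintro m ⟨⟨p, hp, rfl⟩, hm⟩
    rw [height_toFun hp] at hm
    -- Going back by a whole number of turns brings the vertical coordinate into `[0, c]`.
    refine ⟨_, ⟨(p 0, p 1 - ⌊p 1 / c⌋ * c), ⟨hm, ?_⟩, rfl⟩, ?_⟩
    · have h1 := Int.floor_le (p 1 / c)
      have h2 := Int.lt_floor_add_one (p 1 / c)
      rw [le_div_iff₀ hc0] at h1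
      rw [div_lt_iff₀ hc0] at h2
      exact ⟨by simp only; linarith, by simp only; linarith⟩
    · refine (C.eq_iff _ ⟨?_, ?_⟩ _ (openStrip_subset_closedStrip _ hp)).2 ⟨rfl, ⌊p 1 / c⌋, ?_⟩
      · exact hp.1.le
      · exact hp.2.le
      · simp [hc]

/-- On a Hausdorff surface this makes the band closed in `M`, so a curve whose heights stay in `[a,
b]` cannot slip out of the interior in the limit. -/
theorem isCompact_band [IsManifold (𝓡 2) ∞ M] {a b : ℝ} (ha : 0 < a) (hb : b < C.l) :
    IsCompact (C.band a b) := by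
  obtain ⟨R, hR, hRS, hRI, hRm⟩ := C.exists_isCompact_fundamentalDomain ha hb
  have : C.band a b = C.toFun '' R := by
    refine Subset.antisymm (fun m hm ↦ hRm m hm) ?_
    rintro _ ⟨p, hp, rfl⟩
    exact ⟨toFun_mem_interior (hRS hp), by rw [height_toFun (hRS hp)]; exact hRI p hp⟩
  rw [this]
  exact hR.image_of_continuousOn (C.contMDiffOn_openStrip.continuousOn.mono hRS)

/-- This compactness makes the height uniformly controlled by any distance that induces the
topology. -/
theorem isCompact_unitTangent_band [IsManifold (𝓡 2) ∞ M] {a b : ℝ} (ha : 0 < a) (hb : b < C.l) :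
    IsCompact {u : UnitTangentBundle M | u.1.proj ∈ C.band a b} := by
  obtain ⟨R, hR, hRS, hRI, hRm⟩ := C.exists_isCompact_fundamentalDomain ha hb
  rw [Subtype.isCompact_iff]
  have : Subtype.val '' {u : UnitTangentBundle M | u.1.proj ∈ C.band a b} =
      (fun q : Plane × Plane ↦ (⟨C.toFun q.1, C.deriv q.1 q.2⟩ : TangentBundle (𝓡 2) M)) ''
        (R ×ˢ Metric.sphere 0 1) := by
    ext u
    constructor
    · rintro ⟨⟨⟨m, w⟩, hw⟩, hu, rfl⟩
      obtain ⟨p, hp, hpm⟩ := hRm _ hu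
      obtain rfl : C.toFun p = m := hpm
      obtain ⟨ζ, hζ⟩ := deriv_surjective (hRS hp) w
      refine ⟨(p, ζ), ⟨hp, ?_⟩, TotalSpace.ext rfl (heq_of_eq hζ)⟩
      have h1 := metricAt_deriv_self (hRS hp) ζ
      rw [metricAt_self, hζ] at h1
      have h2 : norm (E := TangentSpace (𝓡 2) (C.toFun p)) w = 1 := hw
      rw [h2, one_pow] at h1
      simpa using (pow_eq_one_iff_of_nonneg (norm_nonneg _) two_ne_zero).1 h1.symm
    · rintro ⟨⟨p, ζ⟩, ⟨hp, hζ⟩, rfl⟩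
      have h1 := metricAt_deriv_self (hRS hp) ζ
      rw [metricAt_self, (by simpa using hζ : ‖ζ‖ = 1), one_pow] at h1
      exact ⟨⟨_, (pow_eq_one_iff_of_nonneg (norm_nonneg _) two_ne_zero).1 h1⟩,
        ⟨toFun_mem_interior (hRS hp), by rw [height_toFun (hRS hp)]; exact hRI p hp⟩, rfl⟩
  rw [this]
  exact (hR.prod (isCompact_sphere 0 1)).image_of_continuousOn
    ((C.continuousOn_pushforward).mono fun q hq ↦ hRS hq.1)

variable [IsManifold (𝓡 2) ∞ M] [T2Space M]

/-- A geodesic runs along a straight line as long as this line remains in the cylinder. -/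
theorem isStraightIn_height {γ : ℝ → M} (hγ : ∀ t, IsGeodesicAt γ t) :
    IsStraightIn C.l (fun t ↦ C.height (γ t)) (fun t ↦ C.slope (velocity γ t)) := by
  intro t₁ h₁ t ht
  set s := C.slope (velocity γ t₁) with hs
  set L : ℝ → ℝ := fun t ↦ C.height (γ t₁) + s * (t - t₁) with hL
  have hLc : Continuous L := by fun_prop
  have hLd : ∀ t, HasDerivAt L s t := fun t ↦ by
    have := (((hasDerivAt_id t).sub_const t₁).const_mul s).const_add (C.height (γ t₁))
    rw [mul_one] at this
    exact this
  set O : Set ℝ := L ⁻¹' Ioo 0 C.l with hO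
  have hOo : IsOpen O := isOpen_Ioo.preimage hLc
  have hOc : Convex ℝ O := by
    intro x hx y hy c d hc hd hcd
    have h2 := convex_Ioo (0 : ℝ) C.l hx hy hc hd hcd
    have h3 : c • L x + d • L y = L (c • x + d • y) := by
      simp only [hL, smul_eq_mul]
      linear_combination (C.height (γ t₁) - s * t₁) * hcd
    rwa [h3] at h2
  have hgd : ∀ r, γ r ∈ C.interior → HasDerivAt (fun t ↦ C.slope (velocity γ t)) 0 r :=
    fun r hr ↦ hasDerivAt_slope (Eventually.of_forall hγ) hr
  have hfd : ∀ r, γ r ∈ C.interior →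
      HasDerivAt (fun t ↦ C.height (γ t)) (C.slope (velocity γ r)) r :=
    fun r hr ↦ hasDerivAt_height (hγ r).mdifferentiableAt hr
  have hγc : ∀ r, ContinuousAt γ r := fun r ↦ (hγ r).smooth.continuousAt
  set u : Set ℝ := {r | r ∈ O ∧ γ r ∈ C.interior ∧ C.height (γ r) = L r ∧
    C.slope (velocity γ r) = s} with hu
  have hu_open : IsOpen u := by
    rw [isOpen_iff_mem_nhds]
    rintro r ⟨hrO, hri, hrh, hrs⟩
    obtain ⟨ε, hε, hball⟩ := Metric.eventually_nhds_iff_ball.1 ((hOo.eventually_mem hrO).and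
      ((hγc r).eventually_mem (isOpen_interior.mem_nhds hri)))
    have hpre : IsPreconnected (Metric.ball r ε) := (convex_ball r ε).isPreconnected
    have hr := Metric.mem_ball_self (x := r) hε
    have hsl : ∀ q ∈ Metric.ball r ε, C.slope (velocity γ q) = s := by
      intro q hq
      rw [← hrs]
      exact Metric.isOpen_ball.is_const_of_deriv_eq_zero hpre
        (fun x hx ↦ (hgd x (hball x hx).2).differentiableAt.differentiableWithinAt)
        (fun x hx ↦ (hgd x (hball x hx).2).deriv) hq hr
    have hht : ∀ q ∈ Metric.ball r ε, C.height (γ q) = L q := by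
      have hd : ∀ x ∈ Metric.ball r ε, HasDerivAt (fun t ↦ C.height (γ t) - L t) 0 x := by
        intro x hx
        have := (hfd x (hball x hx).2).sub (hLd x)
        rwa [hsl x hx, sub_self] at this
      intro q hq
      have := Metric.isOpen_ball.is_const_of_deriv_eq_zero hpre
        (fun x hx ↦ (hd x hx).differentiableAt.differentiableWithinAt)
        (fun x hx ↦ (hd x hx).deriv) hq hr
      simp only [hrh, sub_self] at this
      linarith
    exact mem_of_superset (Metric.ball_mem_nhds r hε)
      fun q hq ↦ ⟨(hball q hq).1, (hball q hq).2, hht q hq, hsl q hq⟩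
  have hi₁ : γ t₁ ∈ C.interior := mem_interior_iff.2 h₁.1
  have hL₁ : L t₁ = C.height (γ t₁) := by simp [hL]
  have hsub : O ⊆ u := by
    refine hOc.isPreconnected.subset_of_closure_inter_subset hu_open
      ⟨t₁, ?_, ?_, hi₁, hL₁.symm, hs.symm⟩ ?_
    · simpa [hO, hL₁] using h₁
    · simpa [hO, hL₁] using h₁
    rintro r ⟨hru, hrO⟩
    rw [mem_closure_iff_frequently] at hru
    obtain ⟨a, ha, har⟩ := exists_between hrO.1
    obtain ⟨b, hrb, hb⟩ := exists_between hrO.2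
    have hLev : ∀ᶠ q in 𝓝 r, L q ∈ Icc a b :=
      hLc.continuousAt.eventually_mem (Icc_mem_nhds har hrb)
    -- The height is known to be continuous only on the interior, so the limit point is first placed
    -- there by means of a closed band. Continuity of height and slope then closes the argument.
    have hband : γ r ∈ C.band a b :=
      (isCompact_band ha hb).isClosed.mem_of_frequently_of_tendsto
        ((hru.and_eventually hLev).mono fun q hq ↦ ⟨hq.1.2.1, by rw [hq.1.2.2.1]; exact hq.2⟩)
        (hγc r)
    have hri := hband.1
    exact ⟨hrO, hri,
      tendsto_nhds_unique_of_frequently_eq (hfd r hri).continuousAt hLc.continuousAt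
        (hru.mono fun q hq ↦ hq.2.2.1),
      tendsto_nhds_unique_of_frequently_eq (hgd r hri).continuousAt tendsto_const_nhds
        (hru.mono fun q hq ↦ hq.2.2.2)⟩
  exact ⟨(hsub ht).2.2.1, (hsub ht).2.2.2⟩

end EmbeddedFlatCylinder

end Band

/-! ### Uniform estimates for a distance inducing the given topology -/

section Distance

variable {X : Type*} [t : TopologicalSpace X] (m : MetricSpace X)

theorem eventually_dist_lt_of_toTopologicalSpace_eq (hm : m.toUniformSpace.toTopologicalSpace = t)
    (v : X) {r : ℝ} (hr : 0 < r) : ∀ᶠ w in 𝓝 v, m.dist w v < r := by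
  subst hm
  exact Metric.ball_mem_nhds v hr

/-- Only `x` is confined to `K`: it will be the vector of the given orbit, while nothing is known
beforehand about the position of its shadow `y`. -/
theorem IsCompact.exists_forall_dist_lt_of_toTopologicalSpace_eq
    (hm : m.toUniformSpace.toTopologicalSpace = t) {K : Set X} (hK : IsCompact K) {f : X → ℝ}
    (hf : ∀ x ∈ K, ContinuousAt f x) {ε : ℝ} (hε : 0 < ε) :
    ∃ δ > 0, ∀ x ∈ K, ∀ y, m.dist x y < δ → |f y - f x| < ε := by
  subst hm
  obtain ⟨δ, hδ, h⟩ := Metric.mem_uniformity_dist.1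
    (hK.uniformContinuousAt_of_continuousAt f hf (Metric.dist_mem_uniformity hε))
  exact ⟨δ, hδ, fun x hx y hxy ↦ by rw [abs_sub_comm]; exact h hxy hx⟩

end Distance

/-! ### The geodesic flow near a vertical vector -/

section Closing

set_option maxSynthPendingDepth 3

variable {M : Type*} [EMetricSpace M] [ChartedSpace Plane M]
  [RiemannianBundle (fun x : M ↦ TangentSpace (𝓡 2) x)] [IsManifold (𝓡 2) ∞ M]

namespace EmbeddedFlatCylinder

variable {C : EmbeddedFlatCylinder M}

theorem continuousAt_height_proj {u : UnitTangentBundle M} (hu : u.1.proj ∈ C.interior) :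
    ContinuousAt (fun u : UnitTangentBundle M ↦ C.height u.1.proj) u := by
  have h1 : Continuous fun u : UnitTangentBundle M ↦ u.1.proj :=
    (FiberBundle.continuous_proj Plane (TangentSpace (𝓡 2) : M → Type)).comp continuous_subtype_val
  exact ContinuousAt.comp (f := fun u : UnitTangentBundle M ↦ u.1.proj) (continuousAt_height hu)
    h1.continuousAt

theorem continuousAt_slope_val {u : UnitTangentBundle M} (hu : u.1.proj ∈ C.interior) :
    ContinuousAt (fun u : UnitTangentBundle M ↦ C.slope u.1) u :=
  ContinuousAt.comp (f := fun u : UnitTangentBundle M ↦ u.1) (continuousAt_slope hu)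
    continuous_subtype_val.continuousAt

theorem eventually_proj_mem_interior {u : UnitTangentBundle M} (hu : u.1.proj ∈ C.interior) :
    ∀ᶠ w : UnitTangentBundle M in 𝓝 u, w.1.proj ∈ C.interior := by
  filter_upwards [(continuousAt_height_proj hu).eventually_mem
    (Ioi_mem_nhds (mem_interior_iff.1 hu))] with w hw
  exact mem_interior_iff.2 hw

/-- A vertical vector can be turned a little to either side. -/
theorem frequently_slope_pos {v : UnitTangentBundle M} (hv : v.1.proj ∈ C.interior)
    (h0 : C.slope v.1 = 0) {σ : ℝ} (hσ : σ * σ = 1) : ∃ᶠ u in 𝓝 v, 0 < σ * C.slope u.1 := by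
  obtain ⟨p, hp, ζ, hvp, hnorm⟩ := exists_eq_toFun hv
  rw [hvp, slope_toFun hp] at h0
  have h1 : ζ 1 ^ 2 = 1 := by
    have h2 : ‖ζ‖ ^ 2 = 1 := by rw [← hnorm, v.2, one_pow]
    rw [EuclideanSpace.norm_sq_eq, Fin.sum_univ_two, h0] at h2
    simpa using h2
  -- Since `ζ 1` is `1` or `-1`, this is a circle of unit vectors that passes through `ζ` at `θ = 0`
  -- and leans to the side `σ` for small `θ > 0`.
  set c : ℝ → Plane := fun θ ↦ !₂[σ * Real.sin θ, ζ 1 * Real.cos θ] with hc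
  have hc1 : ∀ θ, ‖c θ‖ ^ 2 = 1 := by
    intro θ
    rw [EuclideanSpace.norm_sq_eq, Fin.sum_univ_two]
    simp only [hc, Real.norm_eq_abs, sq_abs]
    simp only [Matrix.cons_val_zero, Matrix.cons_val_one]
    linear_combination Real.sin θ ^ 2 * hσ + Real.cos θ ^ 2 * h1 + Real.sin_sq_add_cos_sq θ
  have hcc : Continuous c := by fun_prop
  have hu : ∀ θ, norm (E := TangentSpace (𝓡 2) (C.toFun p)) (C.deriv p (c θ)) = 1 := by
    intro θ
    have h2 := metricAt_deriv_self hp (c θ)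
    rw [metricAt_self, hc1] at h2
    exact (pow_eq_one_iff_of_nonneg (norm_nonneg _) two_ne_zero).1 h2
  set u : ℝ → UnitTangentBundle M := fun θ ↦ ⟨⟨C.toFun p, C.deriv p (c θ)⟩, hu θ⟩ with hudef
  have huc : Continuous u := by
    refine Continuous.subtype_mk ?_ _
    exact C.continuousOn_pushforward.comp_continuous (continuous_const.prodMk hcc) fun θ ↦ hp
  have hu0 : u 0 = v := by
    apply Subtype.ext
    rw [hvp]
    have h3 : c 0 = ζ := by
      ext i
      fin_cases i <;> simp [hc, h0]
    simp only [hudef, h3]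
  have h4 : Tendsto u (𝓝[>] 0) (𝓝 v) := by
    rw [← hu0]
    exact huc.continuousAt.tendsto.mono_left nhdsWithin_le_nhds
  refine h4.frequently (Eventually.frequently ?_)
  filter_upwards [Ioo_mem_nhdsGT Real.pi_pos] with θ hθ
  have h5 := Real.sin_pos_of_mem_Ioo hθ
  have h6 : C.slope (u θ).1 = σ * Real.sin θ := by
    rw [hudef, slope_toFun hp]
    simp [hc]
  rw [h6, ← mul_assoc, hσ, one_mul]
  exact h5

/-- A dense set contains vectors arbitrarily close to a vertical one, on either side of it. -/
theorem exists_mem_slope_pos {D : Set (UnitTangentBundle M)} (hD : Dense D)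
    {v : UnitTangentBundle M} (hv : v.1.proj ∈ C.interior) (h0 : C.slope v.1 = 0)
    {N : Set (UnitTangentBundle M)} (hN : N ∈ 𝓝 v) {σ : ℝ} (hσ : σ * σ = 1) :
    ∃ u ∈ D, u ∈ N ∧ 0 < σ * C.slope u.1 := by
  -- The sign of the slope is an open condition at the tilted vector `u`, not at `v`, so density is
  -- applied near `u`.
  obtain ⟨u, hu, hui, huN⟩ := ((frequently_slope_pos hv h0 hσ).and_eventually
    ((eventually_proj_mem_interior hv).and (eventually_mem_nhds_iff.2 hN))).exists
  have h1 : ∀ᶠ w in 𝓝 u, 0 < σ * C.slope w.1 :=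
    ((continuousAt_slope_val hui).const_mul σ).eventually_mem (Ioi_mem_nhds hu)
  obtain ⟨w, ⟨hwN, hw⟩, hwD⟩ := mem_closure_iff_nhds.1 (hD u) _ (inter_mem huN h1)
  exact ⟨w, hwD, hwN, hw⟩

variable [IsContMDiffRiemannianBundle (𝓡 2) ∞ Plane (fun x : M ↦ TangentSpace (𝓡 2) x)]
  [IsRiemannianManifold (𝓡 2) M] [CompleteSpace M]

theorem isStraightIn_geodesicFlow (w : UnitTangentBundle M) :
    IsStraightIn C.l (fun t ↦ C.height (geodesicFlow t w).1.proj)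
      (fun t ↦ C.slope (geodesicFlow t w).1) := by
  obtain ⟨γ, hγ, hw⟩ := exists_isUnitSpeedGeodesic w
  have h := isStraightIn_height (C := C) (isUnitSpeedGeodesic_iff.1 hγ)
  simp only [geodesicFlow_of_velocity_eq hγ hw, add_zero]
  exact h

/-- The vectors whose geodesic remains in the cylinder are vertical. -/
theorem slope_eq_zero_of_forall_mem {v : UnitTangentBundle M}
    (hv : ∀ t, (geodesicFlow t v).1.proj ∈ C.interior) : C.slope v.1 = 0 := by
  obtain ⟨γ, hγ, hγv⟩ := exists_isUnitSpeedGeodesic v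
  have hi : ∀ t, γ t ∈ C.interior := by
    intro t
    have := hv t
    rwa [geodesicFlow_of_velocity_eq hγ hγv, add_zero] at this
  have hγ' := isUnitSpeedGeodesic_iff.1 hγ
  have hs : ∀ t, HasDerivAt (fun s ↦ C.slope (velocity γ s)) 0 t :=
    fun t ↦ hasDerivAt_slope (Eventually.of_forall hγ') (hi t)
  set σ := C.slope v.1 with hσ
  have hst : ∀ t, C.slope (velocity γ t) = σ := by
    intro t
    rw [hσ, ← hγv]
    exact is_const_of_deriv_eq_zero (fun t ↦ (hs t).differentiableAt) (fun t ↦ (hs t).deriv) t 0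
  have hd : ∀ t, HasDerivAt (fun t ↦ C.height (γ t) - σ * t) 0 t := by
    intro t
    have h1 := (hasDerivAt_height (hγ' t).mdifferentiableAt (hi t)).sub
      ((hasDerivAt_id t).const_mul σ)
    rwa [hst, mul_one, sub_self] at h1
  have hh : ∀ t, C.height (γ t) = C.height (γ 0) + σ * t := by
    intro t
    have := is_const_of_deriv_eq_zero (fun t ↦ (hd t).differentiableAt) (fun t ↦ (hd t).deriv) t 0
    simp only [mul_zero, sub_zero] at this
    linarith
  by_contra hne
  -- At this time the affine height would vanish.
  have h1 := mem_interior_iff.1 (hi (-C.height (γ 0) / σ))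
  rw [hh, mul_div_cancel₀ _ hne] at h1
  linarith

theorem geodesicFlow_geodesicFlow (t s : ℝ) (w : UnitTangentBundle M) :
    geodesicFlow t (geodesicFlow s w) = geodesicFlow (t + s) w := by
  obtain ⟨γ, hγ, hw⟩ := exists_isUnitSpeedGeodesic w
  have h1 := geodesicFlow_of_velocity_eq hγ hw
  apply Subtype.ext
  rw [geodesicFlow_of_velocity_eq hγ (s := s) (by rw [h1, add_zero]), h1, add_zero]

theorem geodesicFlow_zero (w : UnitTangentBundle M) : geodesicFlow 0 w = w := by
  obtain ⟨γ, hγ, hw⟩ := exists_isUnitSpeedGeodesic w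
  apply Subtype.ext
  rw [geodesicFlow_of_velocity_eq hγ hw, add_zero, hw]

/-- A geodesic that enters the cylinder on one side of the vertical direction and comes back on the
other side is not shadowed by a closed geodesic of about the same length. -/
theorem not_shadow_of_slope_mul_neg {w w₀ : UnitTangentBundle M} {a b x η T l' : ℝ} (ha : 0 < a)
    (hax : a + 3 * η ≤ x) (hxb : x + 3 * η ≤ b) (hbl : b < C.l)
    (hx0 : |C.height w.1.proj - x| < η) (hxT : |C.height (geodesicFlow T w).1.proj - x| < η)
    (hT : 0 ≤ T) (hg : C.slope w.1 * C.slope (geodesicFlow T w).1 < 0)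
    (hper : geodesicFlow l' w₀ = w₀) (hTl : |T - l'| < η) :
    ¬ ∀ t ∈ Icc 0 T, (geodesicFlow t w).1.proj ∈ C.band a b →
      |C.height (geodesicFlow t w₀).1.proj - C.height (geodesicFlow t w).1.proj| < η := by
  intro h
  refine (isStraightIn_geodesicFlow (C := C) w).not_shadow (isStraightIn_geodesicFlow (C := C) w₀)
    (T := T) (l' := l') ha hax hxb hbl (by simpa only [geodesicFlow_zero]) hxT hT
    (by simpa only [geodesicFlow_zero]) ?_ (by simp only [hper, geodesicFlow_zero]) hTl ?_
  · intro h1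
    exact (abs_slope_le (mem_interior_iff.2 h1.1)).trans_eq (geodesicFlow T w₀).2
  · intro t ht h1
    exact h t ht ⟨mem_interior_iff.2 (ha.trans_le h1.1), h1⟩

/-- Transitivity makes some geodesic pass close to a vertical vector, and return to it from the
other side. -/
theorem exists_geodesicFlow_slope_mul_neg (htrans : GeodesicFlowTransitive M)
    {v : UnitTangentBundle M} (hv : v.1.proj ∈ C.interior) (h0 : C.slope v.1 = 0)
    {N : Set (UnitTangentBundle M)} (hN : N ∈ 𝓝 v) :
    ∃ w ∈ N, ∃ T ≥ 0, geodesicFlow T w ∈ N ∧ C.slope w.1 * C.slope (geodesicFlow T w).1 < 0 := by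
  obtain ⟨w, hw⟩ := htrans
  obtain ⟨_, ⟨t, rfl⟩, htN, ht⟩ := exists_mem_slope_pos hw hv h0 hN (one_mul 1)
  obtain ⟨_, ⟨s, rfl⟩, hsN, hs⟩ := exists_mem_slope_pos hw hv h0 hN (σ := -1) (by norm_num)
  simp only [one_mul, neg_one_mul, Left.neg_pos_iff] at ht hs htN hsN
  -- The order of the two passages is unknown, but the earlier one can always be taken as the start,
  -- since only the sign of the product matters.
  rcases le_total t s with hts | hts
  · refine ⟨_, htN, s - t, sub_nonneg.2 hts, ?_⟩
    rw [geodesicFlow_geodesicFlow, sub_add_cancel]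
    exact ⟨hsN, mul_neg_of_pos_of_neg ht hs⟩
  · refine ⟨_, hsN, t - s, sub_nonneg.2 hts, ?_⟩
    rw [geodesicFlow_geodesicFlow, sub_add_cancel]
    exact ⟨htN, mul_neg_of_neg_of_pos hs ht⟩

end EmbeddedFlatCylinder

end Closing

end

/-! ### Failure of the closing lemma -/

open EmbeddedFlatCylinder

theorem theorem4 {M : Type*} [EMetricSpace M] [ChartedSpace Plane M] [IsManifold (𝓡 2) ∞ M]
    [RiemannianBundle (fun x : M ↦ TangentSpace (𝓡 2) x)]
    [IsContMDiffRiemannianBundle (𝓡 2) ∞ Plane (fun x : M ↦ TangentSpace (𝓡 2) x)]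
    [IsRiemannianManifold (𝓡 2) M] [CompleteSpace M]
    (C : EmbeddedFlatCylinder M) (htrans : GeodesicFlowTransitive M)
    (m : MetricSpace (UnitTangentBundle M))
    (hm : m.toUniformSpace.toTopologicalSpace =
      (instTopologicalSpaceSubtype : TopologicalSpace (UnitTangentBundle M)))
    (v : UnitTangentBundle M) (hv : GeneratesClosedGeodesicIn v C.interior) :
    ¬ ClosingLemmaAround m.dist v := by
  rintro ⟨V, hV, hclose⟩
  have h0 : C.slope v.1 = 0 := slope_eq_zero_of_forall_mem hv.2
  have hvi : v.1.proj ∈ C.interior := by simpa only [geodesicFlow_zero] using hv.2 0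
  set x := C.height v.1.proj with hx
  obtain ⟨hx0, hxl⟩ : x ∈ Ioo 0 C.l := height_mem_Ioo hvi
  -- The band `[a, b]` surrounds the height `x` of `v` inside `(0, l)`, and `η` leaves a margin `3η`
  -- on both sides of `x`.
  set a := x / 2 with ha
  set b := (x + C.l) / 2 with hb
  set η := min ((x - a) / 3) ((b - x) / 3) with hη
  have hη0 : 0 < η := lt_min (by linarith) (by linarith)
  have hax : a + 3 * η ≤ x := by linarith [min_le_left ((x - a) / 3) ((b - x) / 3)]
  have hxb : x + 3 * η ≤ b := by linarith [min_le_right ((x - a) / 3) ((b - x) / 3)]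
  have ha0 : 0 < a := by linarith
  have hbl : b < C.l := by linarith
  obtain ⟨ε, hε, hunif⟩ := (isCompact_unitTangent_band ha0 hbl)
    |>.exists_forall_dist_lt_of_toTopologicalSpace_eq m hm
      (fun u hu ↦ continuousAt_height_proj hu.1) hη0
  obtain ⟨δ, hδ, T₀, hT₀, hclose⟩ := hclose (min ε η) (lt_min hε hη0)
  -- With an initial slope below this bound, covering the distance `2η` takes longer than `T₀`.
  have hκ : 0 < 2 * η / T₀ := by positivity
  obtain ⟨w, ⟨hwV, hwd, hwx, hws⟩, T, hT, ⟨hTV, hTd, hTx, -⟩, hneg⟩ :=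
    exists_geodesicFlow_slope_mul_neg htrans hvi h0 (N := {u | u ∈ V ∧ m.dist u v < δ / 2 ∧
      |C.height u.1.proj - x| < η ∧ |C.slope u.1| < 2 * η / T₀}) (by
        refine inter_mem hV (inter_mem
          (eventually_dist_lt_of_toTopologicalSpace_eq m hm v (half_pos hδ)) (inter_mem ?_ ?_))
        · exact (continuousAt_height_proj hvi).eventually_mem (Metric.ball_mem_nhds x hη0)
        · refine (continuousAt_slope_val hvi).abs.eventually_mem (Iio_mem_nhds ?_)
          rwa [h0, abs_zero])
  -- `T ≥ T₀` is not imposed when `w` is chosen; it follows from the smallness of the slope and the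
  -- turn.
  have hslope : 0 < |C.slope w.1| := abs_pos.2 fun h ↦ by simp [h] at hneg
  have hTT₀ : T₀ ≤ T := by
    have h1 := (isStraightIn_geodesicFlow (C := C) w).div_le_of_turn' (T := T) ha0 hax hxb hbl
      (by simpa only [geodesicFlow_zero]) hT (by simpa only [geodesicFlow_zero])
    simp only [geodesicFlow_zero] at h1
    refine le_trans ?_ h1
    rw [le_div_iff₀ hslope]
    rw [lt_div_iff₀ hT₀] at hws
    linarith
  have hdist : m.dist (geodesicFlow T w) w < δ := by
    have h1 := m.dist_triangle (geodesicFlow T w) v w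
    rw [m.dist_comm v w] at h1
    linarith
  obtain ⟨w₀, l', ⟨-, hper⟩, hTl, hsh⟩ := hclose w hwV T hTT₀ hTV hdist
  exact not_shadow_of_slope_mul_neg ha0 hax hxb hbl hwx hTx hT hneg hper
    (hTl.trans_le (min_le_right _ _)) fun t ht hband ↦
      hunif _ hband _ ((hsh t ht).trans_le (min_le_left _ _))
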